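/- Call a set $I\subseteq\omega$ \emph{$f$-closed}, for a total function $f\colon\omega\to\omega$, if $f(x)\in I$ and $f^{-1}(x)\subseteq I$ for all $x\in I$. An \emph{$f$-block} is a structure $(I,<,f\upharpoonright I)$, where $I\subseteq\omega$ is a finite non-empty $f$-closed interval that is not a disjoint union of two or more non-empty $f$-closed intervals, and $\{x\in\omega : x<y \text{ for all } y\in I\}$ is $f$-closed. The function $f$ is a \emph{block function} if every $a\in\omega$ belongs to some $f$-block. Let $cp_f(x)=\mathrm{card}(f^{-1}(x))$. A \emph{computable copy} of $(\omega,<)$ is a structure $(\omega,\prec)$ isomorphic to $(\omega,<)$ with $\prec$ computable. The \emph{degree spectrum} of $f$ on $(\omega,<)$ is the set of Turing degrees of the images of the graph of $f$ under the isomorphisms from $(\omega,<)$ onto its computable copies. A Turing degree is $\Delta_2$ if it contains a $\Delta_2$ set, i.e. a set that is both $\Sigma_2$ and $\Pi_2$ in the arithmetical hierarchy. \textbf{Theorem.} There exists a computable block function $f\colon\omega\to\omega$ such that: (1) the function $cp_f$ is not computable; (2) each $f$-block occurs infinitely often in $(\omega,<,f)$, i.e. for every $f$-block there are infinitely many $f$-blocks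 isomorphic to it; (3) the degree spectrum of $f$ on $(\omega,<)$ contains all $\Delta_2$ degrees. -/

import Mathlib

/-! ### Turing degrees of sets and relations, Δ₂ degrees -/

open Classical in
/-- The characteristic function of a set of natural numbers, as an oracle. -/
noncomputable def setOracle (S : Set ℕ) : ℕ →. ℕ :=
  fun n => Part.some (if n ∈ S then 1 else 0)

/-- The Turing degree of a set of natural numbers. -/
noncomputable def degSet (S : Set ℕ) : TuringDegree :=
  toAntisymmetrization TuringReducible (setOracle S)

/-- The Turing degree of a binary relation on `ℕ`, coded as a set of natural numbers through the
computable pairing bijection. -/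
noncomputable def degRel (R : ℕ → ℕ → Prop) : TuringDegree :=
  degSet {n | R n.unpair.1 n.unpair.2}

/-- `Σ₂` sets of the arithmetical hierarchy: `n ∈ S ↔ ∃ y, ∀ z, R n y z` with `R` computable. -/
def IsSigma2 (S : Set ℕ) : Prop :=
  ∃ R : ℕ × ℕ × ℕ → Prop, ComputablePred R ∧ ∀ n, n ∈ S ↔ ∃ y, ∀ z, R (n, y, z)

/-- `Δ₂` sets: both the set and its complement are `Σ₂`. -/
def IsDelta2 (S : Set ℕ) : Prop :=
  IsSigma2 S ∧ IsSigma2 Sᶜ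

/-- A Turing degree is `Δ₂` if it contains a `Δ₂` set. -/
def IsDelta2Degree (d : TuringDegree) : Prop :=
  ∃ S : Set ℕ, IsDelta2 S ∧ d = degSet S

/-! ### Computable copies of `(ω, <)` and degree spectra -/

/-- `(ω, r)` is a computable copy of `(ω, <)`. -/
def IsComputableCopy (r : ℕ → ℕ → Prop) : Prop :=
  ComputablePred (fun p : ℕ × ℕ => r p.1 p.2) ∧
    Nonempty (((· < ·) : ℕ → ℕ → Prop) ≃r r)

/-- The degree spectrum of a binary relation `R` on `(ω, <)`: the Turing degrees of the images of
`R` in all computable copies of `(ω, <)`. -/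
def degSpec (R : ℕ → ℕ → Prop) : Set TuringDegree :=
  {d | ∃ r : ℕ → ℕ → Prop, IsComputableCopy r ∧
    ∃ φ : ((· < ·) : ℕ → ℕ → Prop) ≃r r, d = degRel (Relation.Map R φ φ)}

/-- The degree spectrum of a unary total function, that is, of its graph. -/
def degSpecFun (f : ℕ → ℕ) : Set TuringDegree :=
  degSpec (fun x y => f x = y)

/-! ### Block functions -/

/-- `I` is closed under `f` and under `f`-preimages. -/
def FClosed (f : ℕ → ℕ) (I : Set ℕ) : Prop :=
  ∀ x ∈ I, f x ∈ I ∧ f ⁻¹' {x} ⊆ I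

/-- `I` is (the domain of) an `f`-block: a finite non-empty `f`-closed interval which is not a
disjoint union of several (non-empty) `f`-closed intervals, such that the set of all numbers lying
strictly to the left of `I` is `f`-closed. -/
structure IsFBlock (f : ℕ → ℕ) (I : Set ℕ) : Prop where
  finite : I.Finite
  nonempty : I.Nonempty
  interval : I.OrdConnected
  closed : FClosed f I
  indecomposable : ¬ ∃ P : Set (Set ℕ), P.Nontrivial ∧
    (∀ J ∈ P, J.Nonempty ∧ J.OrdConnected ∧ FClosed f J) ∧
    P.PairwiseDisjoint id ∧ ⋃₀ P = I
  left_closed : FClosed f {x | ∀ y ∈ I, x < y}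

/-- `f` is a block function: every number lies in an `f`-block. -/
def IsBlockFunction (f : ℕ → ℕ) : Prop :=
  ∀ a : ℕ, ∃ I : Set ℕ, IsFBlock f I ∧ a ∈ I

/-- The structures `(I, <, f ↾ I)` and `(J, <, f ↾ J)` are isomorphic (for `f`-closed `I`, `J`). -/
def SameFType (f : ℕ → ℕ) (I J : Set ℕ) : Prop :=
  ∃ e : I ≃o J, ∀ x y : I, f x = (y : ℕ) ↔ f (e x) = (e y : ℕ)

/-- The cardinality of the preimage of `x`. (For a block function this preimage is finite, since it
is contained in the block of `x`.) -/
noncomputable def cp (f : ℕ → ℕ) (x : ℕ) : ℕ :=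
  (f ⁻¹' {x}).ncard

/-! ### The block function -/

/-! Call a stage `T` true if `h` never later drops below `h T`. The first new point of stage `s` is
sent back to the end of the last earlier stage whose value is at most `h s`. This destroys the
closedness of the initial segments ending at intermediate stages, which `s` has shown not to be
true. Hence `[0, stageLen (T + 1))` is closed iff `T` is true (`IsTrueStage.fClosed`,
`isTrueStage_of_fClosed`). True stages are unbounded, so `blockFun h` is a block function.

(1) When `f` maps `[0, c)` into itself, that segment is closed iff `cp` sums to `c` on it, so `cp`
decides truth of stages. With `h = haltEnum`, which lists halting programs and tends to infinity, a
true stage of value above `e` certifies that a program `e` still running never halts. A computable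
`cp` would make non-halting r.e.

(2) Every stage copies all that precedes it. At a true stage nothing later interferes with that
copy, so old blocks recur.

(3) Let a computable `a` converge to the set `A`. Names receive positions in stages. At stage `s`
the names from a cut on move into the new copy of `[0, stageLen s)`, and new names fill the gaps. A
cut at the start of the merged segment spares the old names the effect of the merge. Each `n` owns
an adjacent pair of names. At even stages, where `haltEnum` forces no merge, a pair that disagrees
with `a` may become the cut: it is put on two fixed points (code 0) or on a pair with common value
(code 1). The order of names never changes, and `f` changes only at first elements of pairs. Each
name is eventually left of all cuts, so positions converge to an isomorphism onto `(ω, <)`. One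
query reduces `A` to the transported graph, and one query reduces the graph to `A`. -/

/-- The length of the initial segment of the block function that is defined before stage `s`. -/
def stageLen : ℕ → ℕ
  | 0 => 0
  | s + 1 => 2 * stageLen s + 7

/-- The stage at whose beginning the segment merged at stage `s` starts. -/
def target (h : ℕ → ℕ) (s : ℕ) : ℕ :=
  -- Index `i` stands for the boundary at the end of stage `i - 1`, hence the shift; `0` is also the
  -- default when no earlier value is at most `h s`.
  Nat.findGreatest (fun i => h (i - 1) ≤ h s) s

/-- The values of the block function below `stageLen s`. -/
def stageValues (h : ℕ → ℕ) : ℕ → List ℕ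
  | 0 => []
  | s + 1 => stageValues h s ++
      ([stageLen (target h s), stageLen s + 1, stageLen s + 2, stageLen s + 4, stageLen s + 4] ++
        ((stageValues h s).map (fun v => stageLen s + 5 + v) ++
          [2 * stageLen s + 5, 2 * stageLen s + 6]))

/-- The block function built from `h`. At each stage the part built so far is followed by an
element mapped to the beginning of a merged segment, by two fixed points, by a pair with common
value, by a copy of the part built so far, and by two more fixed points. -/
def blockFun (h : ℕ → ℕ) (x : ℕ) : ℕ :=
  (stageValues h (x + 1)).getD x 0

theorem stageLen_succ (s : ℕ) : stageLen (s + 1) = 2 * stageLen s + 7 := rfl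

theorem strictMono_stageLen : StrictMono stageLen :=
  strictMono_nat_of_lt_succ fun s => by rw [stageLen_succ]; omega

theorem le_stageLen (s : ℕ) : s ≤ stageLen s := strictMono_stageLen.le_apply

section BlockFun

variable {h : ℕ → ℕ}

theorem length_stageValues (s : ℕ) : (stageValues h s).length = stageLen s := by
  induction s with
  | zero => rfl
  | succ s ih => simp [stageValues, ih, stageLen_succ]; omega

theorem stageValues_getD_of_le {s t x : ℕ} (hst : s ≤ t) (hx : x < stageLen s) :
    (stageValues h t).getD x 0 = (stageValues h s).getD x 0 := by
  induction t, hst using Nat.le_induction with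
  | base => rfl
  | succ t hst ih =>
    rw [← ih, stageValues, List.getD_append]
    rw [length_stageValues]
    exact hx.trans_le (strictMono_stageLen.monotone hst)

theorem blockFun_eq {s x : ℕ} (hx : x < stageLen s) :
    blockFun h x = (stageValues h s).getD x 0 := by
  rw [blockFun]
  rcases le_total s (x + 1) with hs | hs
  · exact stageValues_getD_of_le hs hx
  · exact (stageValues_getD_of_le hs (le_stageLen (x + 1))).symm

theorem blockFun_add {s j : ℕ} (hj : j < stageLen s + 7) :
    blockFun h (stageLen s + j) =
      ([stageLen (target h s), stageLen s + 1, stageLen s + 2, stageLen s + 4, stageLen s + 4] ++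
        ((stageValues h s).map (fun v => stageLen s + 5 + v) ++
          [2 * stageLen s + 5, 2 * stageLen s + 6])).getD j 0 := by
  rw [blockFun_eq (s := s + 1) (by rw [stageLen_succ]; omega), stageValues,
    List.getD_append_right _ _ _ _ (by rw [length_stageValues]; omega), length_stageValues,
    Nat.add_sub_cancel_left]

theorem blockFun_stageLen (s : ℕ) : blockFun h (stageLen s) = stageLen (target h s) :=
  blockFun_add (j := 0) (by omega)

theorem blockFun_add_one (s : ℕ) : blockFun h (stageLen s + 1) = stageLen s + 1 :=
  blockFun_add (by omega)

theorem blockFun_add_two (s : ℕ) : blockFun h (stageLen s + 2) = stageLen s + 2 :=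
  blockFun_add (by omega)

theorem blockFun_add_three (s : ℕ) : blockFun h (stageLen s + 3) = stageLen s + 4 :=
  blockFun_add (by omega)

theorem blockFun_add_four (s : ℕ) : blockFun h (stageLen s + 4) = stageLen s + 4 :=
  blockFun_add (by omega)

theorem blockFun_copy {s i : ℕ} (hi : i < stageLen s) :
    blockFun h (stageLen s + 5 + i) = stageLen s + 5 + blockFun h i := by
  rw [add_assoc, blockFun_add (by omega), List.getD_append_right _ _ _ _ (by simp),
    List.getD_append _ _ _ _ (by simp [length_stageValues, hi]), blockFun_eq hi]
  simp [List.getD_eq_getElem?_getD, length_stageValues, hi]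

theorem blockFun_last {s j : ℕ} (hj : j < 2) :
    blockFun h (2 * stageLen s + 5 + j) = 2 * stageLen s + 5 + j := by
  rw [show 2 * stageLen s + 5 + j = stageLen s + (stageLen s + 5 + j) by ring,
    blockFun_add (by omega), List.getD_append_right _ _ _ _ (by simp; omega),
    List.getD_append_right _ _ _ _ (by simp [length_stageValues]; omega)]
  have : stageLen s + 5 + j -
      [stageLen (target h s), stageLen s + 1, stageLen s + 2, stageLen s + 4,
        stageLen s + 4].length -
      ((stageValues h s).map (fun v => stageLen s + 5 + v)).length = j := by
    simp [length_stageValues]; omega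
  rw [this]
  interval_cases j <;> simp <;> omega

theorem stage_cases {s i : ℕ} (hi : i < stageLen (s + 1)) :
    i < stageLen s ∨ i = stageLen s ∨ i = stageLen s + 1 ∨ i = stageLen s + 2 ∨
      i = stageLen s + 3 ∨ i = stageLen s + 4 ∨ (∃ j < stageLen s, i = stageLen s + 5 + j) ∨
      ∃ j < 2, i = 2 * stageLen s + 5 + j := by
  rw [stageLen_succ] at hi
  by_cases h1 : i < stageLen s + 5
  · omega
  by_cases h2 : i < 2 * stageLen s + 5
  · exact .inr <| .inr <| .inr <| .inr <| .inr <| .inr <| .inl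
      ⟨i - (stageLen s + 5), by omega, by omega⟩
  · exact .inr <| .inr <| .inr <| .inr <| .inr <| .inr <| .inr
      ⟨i - (2 * stageLen s + 5), by omega, by omega⟩

theorem target_le (s : ℕ) : target h s ≤ s := Nat.findGreatest_le _

theorem stageLen_target_le (s : ℕ) : stageLen (target h s) ≤ stageLen s :=
  strictMono_stageLen.monotone (target_le s)

theorem le_target {s i : ℕ} (hi : i ≤ s) (hh : h (i - 1) ≤ h s) : i ≤ target h s :=
  Nat.le_findGreatest hi hh

theorem apply_target_le {s : ℕ} (hs : target h s ≠ 0) : h (target h s - 1) ≤ h s :=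
  Nat.findGreatest_of_ne_zero (P := fun i => h (i - 1) ≤ h s) rfl hs

theorem lt_of_target_le {s i : ℕ} (hi : target h s ≤ i) (his : i < s) : h s < h i := by
  have := Nat.findGreatest_is_greatest (P := fun i => h (i - 1) ≤ h s) (n := s) (k := i + 1)
    (by simpa [target, Nat.lt_succ_iff] using hi) his
  simpa using this

theorem blockFun_lt {s i : ℕ} (hi : i < stageLen s) : blockFun h i < stageLen s := by
  induction s generalizing i with
  | zero => simp [stageLen] at hi
  | succ s ih =>
    have ht := stageLen_target_le (h := h) s
    have hk := stageLen_succ s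
    rcases stage_cases hi with hi | rfl | rfl | rfl | rfl | rfl | ⟨j, hj, rfl⟩ | ⟨j, hj, rfl⟩
    · have := ih hi
      omega
    · rw [blockFun_stageLen]; omega
    · rw [blockFun_add_one]; omega
    · rw [blockFun_add_two]; omega
    · rw [blockFun_add_three]; omega
    · rw [blockFun_add_four]; omega
    · have := ih hj
      rw [blockFun_copy hj]; omega
    · rw [blockFun_last hj]; omega

/-- The initial segment `[0, q)` is closed for the part of the block function built before
stage `s`. -/
def ClosedAt (h : ℕ → ℕ) (s q : ℕ) : Prop :=
  ∀ i < stageLen s, i < q ↔ blockFun h i < q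

theorem closedAt_of_le {s q : ℕ} (hq : stageLen s ≤ q) : ClosedAt h s q := fun i hi => by
  have := blockFun_lt (h := h) hi
  omega

/-- Only the first point of the new part can map below that part, and its value is still at or
beyond `q`. -/
theorem ClosedAt.succ {s q : ℕ} (hc : ClosedAt h s q) (hq : q ≤ stageLen (target h s)) :
    ClosedAt h (s + 1) q := by
  intro i hi
  have ht := stageLen_target_le (h := h) s
  rcases stage_cases hi with hi | rfl | rfl | rfl | rfl | rfl | ⟨j, hj, rfl⟩ | ⟨j, hj, rfl⟩
  · exact hc i hi
  · rw [blockFun_stageLen]; omega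
  · rw [blockFun_add_one]
  · rw [blockFun_add_two]
  · rw [blockFun_add_three]; omega
  · rw [blockFun_add_four]
  · rw [blockFun_copy hj]; omega
  · rw [blockFun_last hj]

theorem ClosedAt.copy {s q : ℕ} (hc : ClosedAt h s q) :
    ClosedAt h (s + 1) (stageLen s + 5 + q) := by
  intro i hi
  have ht := stageLen_target_le (h := h) s
  rcases stage_cases hi with hi | rfl | rfl | rfl | rfl | rfl | ⟨j, hj, rfl⟩ | ⟨j, hj, rfl⟩
  · have := blockFun_lt (h := h) hi
    omega
  · rw [blockFun_stageLen]; omega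
  · rw [blockFun_add_one]
  · rw [blockFun_add_two]
  · rw [blockFun_add_three]; omega
  · rw [blockFun_add_four]
  · have := hc j hj
    rw [blockFun_copy hj]; omega
  · rw [blockFun_last hj]

/-- Offsets 1 and 3 are where the two gadgets begin: the two fixed points and the pair with common
value. -/
theorem closedAt_add {s g : ℕ} (hg : g = 1 ∨ g = 3) : ClosedAt h (s + 1) (stageLen s + g) := by
  intro i hi
  have ht := stageLen_target_le (h := h) s
  rcases stage_cases hi with hi | rfl | rfl | rfl | rfl | rfl | ⟨j, hj, rfl⟩ | ⟨j, hj, rfl⟩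
  · have := blockFun_lt (h := h) hi
    omega
  · rw [blockFun_stageLen]; omega
  · rw [blockFun_add_one]
  · rw [blockFun_add_two]
  · rw [blockFun_add_three]; omega
  · rw [blockFun_add_four]
  · rw [blockFun_copy hj]; omega
  · rw [blockFun_last hj]

/-- A stage `j` from the target up to, but excluding, `s` has `h j > h s`, so it cannot merge back
past the boundary chosen by `s`. The boundary is therefore still intact at stage `s`. -/
theorem closedAt_stageLen_target (s : ℕ) : ClosedAt h s (stageLen (target h s)) := by
  suffices H : ∀ j, target h s ≤ j → j ≤ s → ClosedAt h j (stageLen (target h s)) from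
    H s (target_le s) le_rfl
  intro j hj
  induction j, hj using Nat.le_induction with
  | base => exact fun _ => closedAt_of_le le_rfl
  | succ j hj ih =>
    intro hjs
    refine (ih (by omega)).succ (strictMono_stageLen.monotone ?_)
    rcases Nat.eq_zero_or_pos (target h s) with h0 | h0
    · omega
    · exact le_target hj ((apply_target_le h0.ne').trans (lt_of_target_le hj hjs).le)

/-- The condition under which no stage after `T` merges a segment that begins before the end of
stage `T`. -/
def IsTrueStage (h : ℕ → ℕ) (T : ℕ) : Prop := ∀ s, T < s → h T ≤ h s

/-- A stage at which `h` attains its minimum on `[N, ∞)` is true. -/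
theorem exists_isTrueStage (N : ℕ) : ∃ T, N ≤ T ∧ IsTrueStage h T := by
  classical
  have hex : ∃ v, ∃ T, N ≤ T ∧ h T = v := ⟨_, N, le_rfl, rfl⟩
  obtain ⟨T, hNT, hT⟩ := Nat.find_spec hex
  exact ⟨T, hNT, fun s hs => hT ▸ Nat.find_min' hex ⟨s, by omega, rfl⟩⟩

theorem IsTrueStage.lt_target {T s : ℕ} (hT : IsTrueStage h T) (hs : T < s) : T < target h s :=
  le_target (i := T + 1) hs (hT s hs)

theorem IsTrueStage.closedAt {T : ℕ} (hT : IsTrueStage h T) (s : ℕ) :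
    ClosedAt h s (stageLen (T + 1)) := by
  rcases le_total s (T + 1) with hs | hs
  · exact closedAt_of_le (strictMono_stageLen.monotone hs)
  · induction s, hs using Nat.le_induction with
    | base => exact closedAt_of_le le_rfl
    | succ s hs ih => exact ih.succ (strictMono_stageLen.monotone (hT.lt_target hs))

theorem fClosed_Iio_iff {f : ℕ → ℕ} {q : ℕ} : FClosed f (Set.Iio q) ↔ ∀ i, i < q ↔ f i < q := by
  constructor
  · exact fun hc i => ⟨fun hi => (hc i hi).1, fun hi => (hc (f i) hi).2 rfl⟩
  · exact fun hc i hi => ⟨(hc i).1 hi, fun j hj => (hc j).2 (by rw [show f j = i from hj]; exact hi)⟩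

theorem fClosed_Iio_of_closedAt {q : ℕ} (hc : ∀ s, ClosedAt h s q) :
    FClosed (blockFun h) (Set.Iio q) :=
  fClosed_Iio_iff.2 fun i => hc (i + 1) i (le_stageLen (i + 1))

theorem IsTrueStage.fClosed {T : ℕ} (hT : IsTrueStage h T) :
    FClosed (blockFun h) (Set.Iio (stageLen (T + 1))) :=
  fClosed_Iio_of_closedAt hT.closedAt

theorem isTrueStage_of_fClosed {T : ℕ}
    (hT : FClosed (blockFun h) (Set.Iio (stageLen (T + 1)))) : IsTrueStage h T := by
  classical
  by_contra hnot
  have hex : ∃ s, T < s ∧ h s < h T := by simpa [IsTrueStage] using hnot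
  obtain ⟨hs, hlt⟩ := Nat.find_spec hex
  set s := Nat.find hex
  -- For the first `s > T` with `h s < h T`, a target beyond `T` would come from a stage in `[T, s)`
  -- of value at most `h s`. It cannot be `T`, and a later one contradicts the minimality of `s`.
  have hts : target h s < T + 1 := by
    by_contra! hle
    have h1 := apply_target_le (h := h) (s := s) (by omega)
    have h2 := target_le (h := h) s
    rcases hle.lt_or_eq with hlt' | heq
    · exact Nat.find_min hex (m := target h s - 1) (by omega) ⟨by omega, by omega⟩
    · rw [← heq, Nat.add_sub_cancel] at h1
      omega
  have h1 := (fClosed_Iio_iff.1 hT (stageLen s)).2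
    (by rw [blockFun_stageLen]; exact strictMono_stageLen hts)
  exact absurd (strictMono_stageLen.lt_iff_lt.1 h1) (by omega)

end BlockFun

/-! ### Blocks -/

theorem FClosed.diff {f : ℕ → ℕ} {I J : Set ℕ} (hI : FClosed f I) (hJ : FClosed f J) :
    FClosed f (I \ J) := fun x hx =>
  ⟨⟨(hI x hx.1).1, fun hfx => hx.2 ((hJ _ hfx).2 rfl)⟩, fun y hy =>
    ⟨(hI x hx.1).2 hy, fun hyJ => hx.2 ((Set.mem_singleton_iff.1 hy) ▸ (hJ y hyJ).1)⟩⟩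

theorem FClosed.union {f : ℕ → ℕ} {I J : Set ℕ} (hI : FClosed f I) (hJ : FClosed f J) :
    FClosed f (I ∪ J) := fun x hx => hx.elim
  (fun hx => ⟨.inl (hI x hx).1, (hI x hx).2.trans Set.subset_union_left⟩)
  (fun hx => ⟨.inr (hJ x hx).1, (hJ x hx).2.trans Set.subset_union_right⟩)

theorem Iio_diff_Iio_nat (a b : ℕ) : Set.Iio b \ Set.Iio a = Set.Ico a b := by
  ext x; simp

theorem setOf_forall_Ico_lt {a b : ℕ} (hab : a < b) :
    {x | ∀ y ∈ Set.Ico a b, x < y} = Set.Iio a := by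
  ext x
  exact ⟨fun hx => hx a ⟨le_rfl, hab⟩, fun hx y hy => lt_of_lt_of_le hx hy.1⟩

/-- Consecutive closed initial segments bound an `f`-block. -/
theorem isFBlock_Ico {f : ℕ → ℕ} {a b : ℕ} (hab : a < b) (ha : FClosed f (Set.Iio a))
    (hb : FClosed f (Set.Iio b)) (hc : ∀ c, a < c → c < b → ¬ FClosed f (Set.Iio c)) :
    IsFBlock f (Set.Ico a b) where
  finite := Set.finite_Ico a b
  nonempty := ⟨a, le_rfl, hab⟩
  interval := Set.ordConnected_Ico
  closed := by
    rw [← Iio_diff_Iio_nat]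
    exact hb.diff ha
  left_closed := by rwa [setOf_forall_Ico_lt hab]
  indecomposable := by
    rintro ⟨P, hP, hJ, hdisj, hU⟩
    obtain ⟨J, hJP, haJ⟩ : a ∈ ⋃₀ P := hU ▸ ⟨le_rfl, hab⟩
    obtain ⟨J', hJ'P, hne⟩ := hP.exists_ne J
    obtain ⟨y, hy⟩ := (hJ J' hJ'P).1
    have hyI : y ∈ Set.Ico a b := hU ▸ ⟨J', hJ'P, hy⟩
    have hyJ : y ∉ J := fun hyJ => Set.disjoint_left.1 (hdisj hJP hJ'P hne.symm) hyJ hy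
    have hJI : J ⊆ Set.Ico a b := hU ▸ Set.subset_sUnion_of_mem hJP
    classical
    -- The piece `J` containing `a` is an interval. Its first gap `c` gives `[0, c) = [0, a) ∪ J`, a
    -- closed initial segment strictly between the two bounds.
    have hex : ∃ c, a ≤ c ∧ c ∉ J := ⟨y, hyI.1, hyJ⟩
    obtain ⟨hac, hcJ⟩ := Nat.find_spec hex
    have hmin : ∀ {m}, m < Nat.find hex → a ≤ m → m ∈ J := fun hm ham => by
      by_contra hmJ
      exact Nat.find_min hex hm ⟨ham, hmJ⟩
    have hcy := Nat.find_min' hex ⟨hyI.1, hyJ⟩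
    set c := Nat.find hex
    have hac' : a < c := lt_of_le_of_ne hac fun h => hcJ (h ▸ haJ)
    refine hc c hac' (lt_of_le_of_lt hcy hyI.2) ?_
    have : Set.Iio c = Set.Iio a ∪ J := by
      ext x
      simp only [Set.mem_Iio, Set.mem_union]
      constructor
      · intro hx
        exact (lt_or_ge x a).imp_right (hmin hx)
      · rintro (hx | hx)
        · exact hx.trans hac'
        · by_contra! hcx
          exact hcJ ((hJ J hJP).2.1.out haJ hx ⟨hac, hcx⟩)
    rw [this]
    exact ha.union (hJ J hJP).2.2

/-- Converse of `isFBlock_Ico`: a closed initial segment ending strictly inside the block would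
split it into two closed intervals. -/
theorem IsFBlock.exists_eq_Ico {f : ℕ → ℕ} {I : Set ℕ} (hI : IsFBlock f I) :
    ∃ a b, a < b ∧ I = Set.Ico a b ∧ FClosed f (Set.Iio a) ∧ FClosed f (Set.Iio b) ∧
      ∀ c, a < c → c < b → ¬ FClosed f (Set.Iio c) := by
  obtain ⟨a, haI, ha⟩ := Set.exists_min_image I id hI.finite hI.nonempty
  obtain ⟨b, hbI, hb⟩ := Set.exists_max_image I id hI.finite hI.nonempty
  have hIab : I = Set.Ico a (b + 1) := by
    ext x
    exact ⟨fun hx => ⟨ha x hx, Nat.lt_succ_of_le (hb x hx)⟩,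
      fun hx => hI.interval.out haI hbI ⟨hx.1, Nat.le_of_lt_succ hx.2⟩⟩
  have hab : a < b + 1 := Nat.lt_succ_of_le (ha b hbI)
  have hca : FClosed f (Set.Iio a) := by
    have := hI.left_closed
    rwa [hIab, setOf_forall_Ico_lt hab] at this
  have hcb : FClosed f (Set.Iio (b + 1)) := by
    have := hca.union (hIab ▸ hI.closed)
    rwa [Set.Iio_union_Ico_eq_Iio hab.le] at this
  refine ⟨a, b + 1, hab, hIab, hca, hcb, fun c hac hcb' hc => hI.indecomposable ?_⟩
  refine ⟨{Set.Ico a c, Set.Ico c (b + 1)}, ?_, ?_, ?_, ?_⟩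
  · refine Set.nontrivial_pair fun heq => ?_
    have : a ∈ Set.Ico c (b + 1) := heq ▸ ⟨le_rfl, hac⟩
    exact absurd this.1 (by omega)
  · rintro J (rfl | rfl)
    · exact ⟨⟨a, le_rfl, hac⟩, Set.ordConnected_Ico, Iio_diff_Iio_nat a c ▸ hc.diff hca⟩
    · exact ⟨⟨c, le_rfl, hcb'⟩, Set.ordConnected_Ico, Iio_diff_Iio_nat c (b + 1) ▸ hcb.diff hc⟩
  · have hd : Disjoint (Set.Ico a c) (Set.Ico c (b + 1)) :=
      Set.disjoint_left.2 fun x hx hx' => absurd hx.2 (not_lt.2 hx'.1)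
    rintro J (rfl | rfl) J' (rfl | rfl) hne
    · exact absurd rfl hne
    · exact hd
    · exact hd.symm
    · exact absurd rfl hne
  · rw [Set.sUnion_pair, hIab, Set.Ico_union_Ico_eq_Ico hac.le hcb'.le]

/-- The block of `x` runs from the last closed boundary at or before `x` to the first one after it.
-/
theorem isBlockFunction_of_unbounded {f : ℕ → ℕ}
    (hf : ∀ a, ∃ c, a < c ∧ FClosed f (Set.Iio c)) : IsBlockFunction f := by
  classical
  intro x
  have h0 : FClosed f (Set.Iio 0) := fun y hy => absurd hy (Nat.not_lt_zero y)
  have ha := Nat.findGreatest_spec (P := fun c => FClosed f (Set.Iio c)) (Nat.zero_le x) h0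
  have hax := Nat.findGreatest_le (P := fun c => FClosed f (Set.Iio c)) x
  obtain ⟨hxb, hb⟩ := Nat.find_spec (hf x)
  refine ⟨_, isFBlock_Ico (hax.trans_lt hxb) ha hb fun c hac hcb hc => ?_, hax, hxb⟩
  rcases le_or_gt c x with hcx | hcx
  · exact Nat.findGreatest_is_greatest hac hcx hc
  · exact Nat.find_min (hf x) hcb ⟨hcx, hc⟩

/-! ### Blocks of the constructed function and their recurrence -/

section BlockFun

variable {h : ℕ → ℕ}

theorem exists_isTrueStage_gt (a : ℕ) : ∃ T, IsTrueStage h T ∧ a < stageLen T := by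
  obtain ⟨T, haT, hT⟩ := exists_isTrueStage (h := h) (a + 1)
  exact ⟨T, hT, haT.trans (le_stageLen T)⟩

theorem isBlockFunction_blockFun : IsBlockFunction (blockFun h) :=
  isBlockFunction_of_unbounded fun a => by
    obtain ⟨T, hT, ha⟩ := exists_isTrueStage_gt (h := h) a
    exact ⟨_, ha.trans (strictMono_stageLen T.lt_succ_self), hT.fClosed⟩

/-- After a true stage nothing maps into `[0, stageLen (T + 1))` from outside, so closedness inside
the copy only reflects the part that was copied. -/
theorem IsTrueStage.fClosed_copy_iff {T q : ℕ} (hT : IsTrueStage h T) (hq : q ≤ stageLen T) :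
    FClosed (blockFun h) (Set.Iio (stageLen T + 5 + q)) ↔ ClosedAt h T q := by
  rw [fClosed_Iio_iff]
  have hlen := stageLen_succ T
  constructor
  · intro hc i hi
    have := hc (stageLen T + 5 + i)
    rw [blockFun_copy hi] at this
    omega
  · intro hc i
    have h1 := fClosed_Iio_iff.1 hT.fClosed i
    rcases lt_or_ge i (stageLen (T + 1)) with hi | hi
    · exact hc.copy i hi
    · omega

theorem closedAt_of_fClosed {q : ℕ} (hq : FClosed (blockFun h) (Set.Iio q)) (s : ℕ) :
    ClosedAt h s q := fun i _ => fClosed_Iio_iff.1 hq i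

theorem IsTrueStage.fClosed_of_closedAt_of_le {T q : ℕ} (hT : IsTrueStage h T)
    (hc : ClosedAt h (T + 1) q) (hq : q ≤ stageLen (T + 1)) :
    FClosed (blockFun h) (Set.Iio q) := by
  rw [fClosed_Iio_iff]
  intro i
  rcases lt_or_ge i (stageLen (T + 1)) with hi | hi
  · exact hc i hi
  · have h1 := fClosed_Iio_iff.1 hT.fClosed i
    omega

/-- Every block of the block function has a copy right after each later true stage. -/
theorem IsFBlock.copy {I : Set ℕ} (hI : IsFBlock (blockFun h) I) {T₀ T : ℕ}
    (hT₀ : IsTrueStage h T₀) (hIT : I ⊆ Set.Iio (stageLen (T₀ + 1))) (hT : IsTrueStage h T)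
    (hlt : T₀ < T) :
    IsFBlock (blockFun h) ((fun x => stageLen T + 5 + x) '' I) ∧
      SameFType (blockFun h) I ((fun x => stageLen T + 5 + x) '' I) := by
  obtain ⟨a, b, hab, rfl, ha, hb, hc⟩ := hI.exists_eq_Ico
  have hT₀T : stageLen (T₀ + 1) ≤ stageLen T := strictMono_stageLen.monotone hlt
  have hbT : b - 1 < stageLen (T₀ + 1) := hIT ⟨by omega, by omega⟩
  constructor
  · rw [Set.image_const_add_Ico]
    refine isFBlock_Ico (by omega) ?_ ?_ ?_
    · exact (hT.fClosed_copy_iff (by omega)).2 (closedAt_of_fClosed ha T)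
    · exact (hT.fClosed_copy_iff (by omega)).2 (closedAt_of_fClosed hb T)
    · intro c hac hcb hcc
      obtain ⟨c, rfl⟩ : ∃ d, c = stageLen T + 5 + d := ⟨c - (stageLen T + 5), by omega⟩
      rw [hT.fClosed_copy_iff (by omega)] at hcc
      -- A closed boundary inside the copy pulls back to one at stage `T`. Truth of `T₀` makes it
      -- closed for the whole function, against the indecomposability of the block.
      refine hc c (by omega) (by omega) (hT₀.fClosed_of_closedAt_of_le ?_ (by omega))
      exact fun i hi => hcc i (hi.trans_le hT₀T)
  · let e : Set.Ico a b ≃o ((fun x => stageLen T + 5 + x) '' Set.Ico a b) :=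
      { toEquiv := Equiv.Set.image _ _ (add_right_injective _)
        map_rel_iff' := by
          rintro ⟨x, hx⟩ ⟨y, hy⟩
          exact Nat.add_le_add_iff_left }
    refine ⟨e, ?_⟩
    rintro ⟨x, hx⟩ ⟨y, hy⟩
    change blockFun h x = y ↔ blockFun h (stageLen T + 5 + x) = stageLen T + 5 + y
    rw [blockFun_copy (by have := hx.2; omega)]
    omega

theorem infinite_sameFType {I : Set ℕ} (hI : IsFBlock (blockFun h) I) :
    {J : Set ℕ | IsFBlock (blockFun h) J ∧ SameFType (blockFun h) I J}.Infinite := by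
  obtain ⟨m, hm⟩ := hI.finite.bddAbove
  obtain ⟨T₀, hT₀, hmT⟩ := exists_isTrueStage_gt (h := h) m
  have hIT : I ⊆ Set.Iio (stageLen (T₀ + 1)) := fun x hx =>
    (hm hx).trans_lt (hmT.trans (strictMono_stageLen T₀.lt_succ_self))
  have hinf : {T | IsTrueStage h T ∧ T₀ < T}.Infinite :=
    Set.infinite_of_forall_exists_gt fun n => by
      obtain ⟨T, hnT, hT⟩ := exists_isTrueStage (h := h) (n + T₀ + 1)
      exact ⟨T, ⟨hT, by omega⟩, by omega⟩
  refine Set.infinite_of_injOn_mapsTo (f := fun T => (fun x => stageLen T + 5 + x) '' I) ?_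
    (fun T hT => hI.copy hT₀ hIT hT.1 hT.2) hinf
  obtain ⟨a, haI, ha⟩ := Set.exists_min_image I id hI.finite hI.nonempty
  simp only [id] at ha
  intro T _ T' _ heq
  simp only at heq
  refine strictMono_stageLen.injective ?_
  obtain ⟨x, hx, hx'⟩ : stageLen T + 5 + a ∈ (fun x => stageLen T' + 5 + x) '' I :=
    heq ▸ ⟨a, haI, rfl⟩
  obtain ⟨y, hy, hy'⟩ : stageLen T' + 5 + a ∈ (fun x => stageLen T + 5 + x) '' I :=
    heq ▸ ⟨a, haI, rfl⟩
  have h1 := ha x hx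
  have h2 := ha y hy
  simp only at hx' hy'
  omega

end BlockFun

/-! ### Counting preimages -/

theorem IsBlockFunction.finite_preimage {f : ℕ → ℕ} (hf : IsBlockFunction f) (x : ℕ) :
    (f ⁻¹' {x}).Finite := by
  obtain ⟨I, hI, hxI⟩ := hf x
  exact hI.finite.subset (hI.closed x hxI).2

theorem IsBlockFunction.sum_cp {f : ℕ → ℕ} (hf : IsBlockFunction f) (c : ℕ) :
    (f ⁻¹' Set.Iio c).Finite ∧ ∑ x ∈ Finset.range c, cp f x = (f ⁻¹' Set.Iio c).ncard := by
  induction c with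
  | zero => simp
  | succ c ih =>
    have heq : f ⁻¹' Set.Iio (c + 1) = f ⁻¹' Set.Iio c ∪ f ⁻¹' {c} := by
      ext x; simp [Nat.le_iff_lt_or_eq]
    rw [heq]
    refine ⟨ih.1.union (hf.finite_preimage c), ?_⟩
    rw [Finset.sum_range_succ, ih.2, cp, Set.ncard_union_eq _ ih.1 (hf.finite_preimage c)]
    exact Set.disjoint_left.2 fun x hx hx' => by simp at hx hx'; omega

/-- The sum counts all preimages of `[0, c)`. These include `[0, c)` itself, so the count is `c`
exactly when there are no others. -/
theorem IsBlockFunction.fClosed_Iio_iff_sum_cp {f : ℕ → ℕ} (hf : IsBlockFunction f) {c : ℕ}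
    (hc : ∀ i < c, f i < c) :
    FClosed f (Set.Iio c) ↔ ∑ x ∈ Finset.range c, cp f x = c := by
  rw [(hf.sum_cp c).2, fClosed_Iio_iff]
  have hsub : Set.Iio c ⊆ f ⁻¹' Set.Iio c := hc
  have hcard : (Set.Iio c).ncard = c := by
    rw [← Finset.coe_Iio, Set.ncard_coe_finset, Nat.card_Iio]
  constructor
  · intro H
    rw [show f ⁻¹' Set.Iio c = Set.Iio c from Set.ext fun i => (H i).symm, hcard]
  · intro H i
    have := Set.eq_of_subset_of_ncard_le hsub (by omega) (hf.sum_cp c).1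
    exact Set.ext_iff.1 this i

/-! ### Computability of the block function -/

theorem primrec_stageLen : Primrec stageLen := by
  refine (Primrec.nat_rec' (f := fun s : ℕ => s) (g := fun _ => 0)
    (h := fun _ p => 2 * p.2 + 7) Primrec.id (Primrec.const 0) ?_).of_eq fun s => ?_
  · exact (Primrec.nat_add.comp (Primrec.nat_mul.comp (Primrec.const 2)
      (Primrec.snd.comp Primrec.snd)) (Primrec.const 7)).to₂
  · induction s with
    | zero => rfl
    | succ s ih => rw [stageLen_succ, ← ih]

theorem primrec_target {h : ℕ → ℕ} (hh : Primrec h) : Primrec (target h) :=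
  Primrec.nat_findGreatest Primrec.id
    (Primrec.nat_le.comp (hh.comp (Primrec.pred.comp Primrec.snd)) (hh.comp Primrec.fst))

theorem primrec_stageValues {h : ℕ → ℕ} (hh : Primrec h) : Primrec (stageValues h) := by
  refine (Primrec.nat_rec' (f := fun s : ℕ => s) (g := fun _ => ([] : List ℕ))
    (h := fun _ p => p.2 ++
      ([stageLen (target h p.1), stageLen p.1 + 1, stageLen p.1 + 2, stageLen p.1 + 4,
        stageLen p.1 + 4] ++ (p.2.map (fun v => stageLen p.1 + 5 + v) ++
          [2 * stageLen p.1 + 5, 2 * stageLen p.1 + 6])))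
    Primrec.id (Primrec.const []) ?_).of_eq fun s => ?_
  · have hs : Primrec fun q : ℕ × ℕ × List ℕ => q.2.1 := Primrec.fst.comp Primrec.snd
    have hl : Primrec fun q : ℕ × ℕ × List ℕ => q.2.2 := Primrec.snd.comp Primrec.snd
    have hk : Primrec fun q : ℕ × ℕ × List ℕ => stageLen q.2.1 := primrec_stageLen.comp hs
    have hk' (c : ℕ) : Primrec fun q : ℕ × ℕ × List ℕ => stageLen q.2.1 + c :=
      Primrec.nat_add.comp hk (Primrec.const c)
    have hkk (c : ℕ) : Primrec fun q : ℕ × ℕ × List ℕ => 2 * stageLen q.2.1 + c :=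
      Primrec.nat_add.comp (Primrec.nat_mul.comp (Primrec.const 2) hk) (Primrec.const c)
    have hm : Primrec fun q : ℕ × ℕ × List ℕ => stageLen (target h q.2.1) :=
      primrec_stageLen.comp ((primrec_target hh).comp hs)
    refine Primrec.list_append.comp hl (Primrec.list_append.comp ?_
      (Primrec.list_append.comp ?_ ?_))
    · exact Primrec.list_cons.comp hm (Primrec.list_cons.comp (hk' 1) (Primrec.list_cons.comp
        (hk' 2) (Primrec.list_cons.comp (hk' 4) (Primrec.list_cons.comp (hk' 4)
          (Primrec.const [])))))
    · exact Primrec.list_map hl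
        (Primrec.nat_add.comp ((hk' 5).comp Primrec.fst) Primrec.snd).to₂
    · exact Primrec.list_cons.comp (hkk 5) (Primrec.list_cons.comp (hkk 6) (Primrec.const []))
  · induction s with
    | zero => rfl
    | succ s ih => rw [stageValues, ← ih]

theorem primrec_blockFun {h : ℕ → ℕ} (hh : Primrec h) : Primrec (blockFun h) :=
  (Primrec.list_getD 0).comp ((primrec_stageValues hh).comp Primrec.succ) Primrec.id

/-! ### Enumerating the halting problem -/

open Nat.Partrec in
/-- The `e`-th program halts on input `0` after exactly `k + 1` steps. -/
def haltsExactlyAt (e k : ℕ) : Bool :=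
  (Code.evaln (k + 1) (Denumerable.ofNat Code e) 0).isSome &&
    !(Code.evaln k (Denumerable.ofNat Code e) 0).isSome

/-- A function listing the programs that halt at the odd arguments, in the order of their halting
times, and equal to the identity elsewhere. -/
def haltEnum (s : ℕ) : ℕ :=
  bif s.bodd && haltsExactlyAt s.div2.unpair.1 s.div2.unpair.2 then s.div2.unpair.1 else s

open Nat.Partrec in
theorem primrec_evaln_isSome :
    Primrec₂ fun (c : Code) (k : ℕ) => (Code.evaln k c 0).isSome :=
  Primrec.option_isSome.comp (Code.primrec_evaln.comp
    (Primrec.pair (Primrec.pair Primrec.snd Primrec.fst) (Primrec.const 0)))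

theorem primrec_haltsExactlyAt : Primrec₂ haltsExactlyAt :=
  Primrec.and.comp
    (primrec_evaln_isSome.comp ((Primrec.ofNat _).comp Primrec.fst)
      (Primrec.succ.comp Primrec.snd))
    (Primrec.not.comp (primrec_evaln_isSome.comp ((Primrec.ofNat _).comp Primrec.fst) Primrec.snd))

theorem primrec_haltEnum : Primrec haltEnum := by
  have hu : Primrec fun s : ℕ => s.div2.unpair := Primrec.unpair.comp Primrec.nat_div2
  exact Primrec.cond (Primrec.and.comp Primrec.nat_bodd (primrec_haltsExactlyAt.comp
    (Primrec.fst.comp hu) (Primrec.snd.comp hu))) (Primrec.fst.comp hu) Primrec.id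

theorem haltEnum_le (s : ℕ) : haltEnum s ≤ s := by
  rw [haltEnum]
  have h1 := Nat.unpair_left_le s.div2
  have h2 : s.div2 ≤ s := by rw [Nat.div2_val]; omega
  cases s.bodd && haltsExactlyAt s.div2.unpair.1 s.div2.unpair.2
  · simp
  · simp; omega

theorem haltEnum_bit0 (j : ℕ) : haltEnum (2 * j) = 2 * j := by
  simp [haltEnum]

/-- An even argument has a value above all earlier ones, so even stages merge nothing and are free
for coding. -/
theorem target_haltEnum_bit0 (j : ℕ) : target haltEnum (2 * j) = 2 * j := by
  refine le_antisymm (target_le _) (le_target le_rfl ?_)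
  have := haltEnum_le (2 * j - 1)
  rw [haltEnum_bit0]
  omega

theorem haltEnum_of_halts {e k : ℕ} (hk : haltsExactlyAt e k = true) :
    haltEnum (2 * Nat.pair e k + 1) = e := by
  have h2 : (2 * Nat.pair e k + 1).div2 = Nat.pair e k := by rw [Nat.div2_val]; omega
  rw [haltEnum, h2]
  simp [hk]

open Nat.Partrec in
theorem evaln_isSome_mono {c : Code} {k l : ℕ} (hkl : k ≤ l)
    (hk : (Code.evaln k c 0).isSome = true) : (Code.evaln l c 0).isSome = true := by
  obtain ⟨v, hv⟩ := Option.isSome_iff_exists.1 hk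
  exact Option.isSome_iff_exists.2 ⟨v, Code.evaln_mono hkl hv⟩

theorem haltsExactlyAt_unique {e k l : ℕ} (hk : haltsExactlyAt e k = true)
    (hl : haltsExactlyAt e l = true) : k = l := by
  simp only [haltsExactlyAt, Bool.and_eq_true, Bool.not_eq_true'] at hk hl
  rcases lt_trichotomy k l with hlt | heq | hlt
  · exact absurd (evaln_isSome_mono hlt hk.1) (by simp [hl.2])
  · exact heq
  · exact absurd (evaln_isSome_mono hlt hl.1) (by simp [hk.2])

open Nat.Partrec in
theorem exists_haltsExactlyAt {c : Code} (hc : (Code.eval c 0).Dom) :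
    ∃ k, haltsExactlyAt (Encodable.encode c) k = true := by
  classical
  have hex : ∃ k, (Code.evaln k c 0).isSome = true := by
    obtain ⟨v, hv⟩ := Part.dom_iff_mem.1 hc
    obtain ⟨k, hk⟩ := Code.evaln_complete.1 hv
    exact ⟨k, Option.isSome_iff_exists.2 ⟨v, hk⟩⟩
  -- The least successful bound is positive because `evaln` with bound `0` never returns a value.
  obtain ⟨k, hk⟩ : ∃ k, Nat.find hex = k + 1 := by
    refine Nat.exists_eq_succ_of_ne_zero fun h0 => ?_
    have := Nat.find_spec hex
    rw [h0] at this
    simp [Code.evaln] at this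
  refine ⟨k, ?_⟩
  have h1 := Nat.find_spec hex
  have h2 := Nat.find_min hex (m := k) (by omega)
  rw [hk] at h1
  simpa [haltsExactlyAt, h1] using h2

/-- `haltEnum` tends to infinity: apart from the argument `e`, the value `e` is taken at most once,
since the exact halting time is unique. -/
theorem exists_forall_lt_haltEnum (e : ℕ) : ∃ M, ∀ s, M ≤ s → e ≤ haltEnum s := by
  induction e with
  | zero => exact ⟨0, fun s _ => Nat.zero_le _⟩
  | succ e ih =>
    obtain ⟨M, hM⟩ := ih
    obtain ⟨N, hN⟩ : ∃ N, ∀ s, N ≤ s → haltEnum s = e → s = e := by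
      by_cases hex : ∃ k, haltsExactlyAt e k = true
      · obtain ⟨k, hk⟩ := hex
        refine ⟨2 * Nat.pair e k + 2, fun s hs hse => ?_⟩
        rw [haltEnum] at hse
        by_contra hne
        rcases hb : s.bodd && haltsExactlyAt s.div2.unpair.1 s.div2.unpair.2
        · rw [hb] at hse
          exact hne hse
        · rw [hb, cond_true] at hse
          rw [Bool.and_eq_true, hse] at hb
          have h1 := haltsExactlyAt_unique hb.2 hk
          have h2 : s.div2 = Nat.pair e k := by rw [← hse, ← h1, Nat.pair_unpair]
          rw [Nat.div2_val] at h2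
          omega
      · refine ⟨0, fun s _ hse => ?_⟩
        rw [haltEnum] at hse
        rcases hb : s.bodd && haltsExactlyAt s.div2.unpair.1 s.div2.unpair.2
        · rw [hb] at hse
          exact hse
        · rw [hb, cond_true] at hse
          rw [Bool.and_eq_true, hse] at hb
          exact absurd ⟨_, hb.2⟩ hex
    refine ⟨M + N + e + 1, fun s hs => ?_⟩
    have h1 := hM s (by omega)
    rcases h1.lt_or_eq with h1 | h1
    · exact h1
    · have := hN s (by omega) h1.symm
      omega

-- If `c` halts, its code is listed at some stage. A true stage of larger value cannot precede that
-- stage, so by then the computation has already been seen to halt. Conversely, large true stages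
-- exist because `haltEnum` tends to infinity.
open Nat.Partrec in
theorem not_halts_iff (c : Code) :
    ¬ (Code.eval c 0).Dom ↔ ∃ T, IsTrueStage haltEnum T ∧ Encodable.encode c < haltEnum T ∧
      (Code.evaln T c 0).isSome = false := by
  constructor
  · intro hc
    obtain ⟨M, hM⟩ := exists_forall_lt_haltEnum (Encodable.encode c + 1)
    obtain ⟨T, hMT, hT⟩ := exists_isTrueStage (h := haltEnum) M
    refine ⟨T, hT, hM T hMT, ?_⟩
    by_contra hsome
    obtain ⟨v, hv⟩ := Option.isSome_iff_exists.1 (Bool.not_eq_false _ ▸ hsome)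
    exact hc (Part.dom_iff_mem.2 ⟨v, Code.evaln_sound hv⟩)
  · rintro ⟨T, hT, hlt, hnone⟩ hc
    obtain ⟨k, hk⟩ := exists_haltsExactlyAt hc
    have h1 := haltEnum_of_halts hk
    rcases lt_or_ge T (2 * Nat.pair (Encodable.encode c) k + 1) with hs | hs
    · have := hT _ hs
      omega
    · have hkT : k + 1 ≤ T := by
        have := Nat.right_le_pair (Encodable.encode c) k
        omega
      rw [haltsExactlyAt, Bool.and_eq_true, Denumerable.ofNat_encode] at hk
      rw [evaln_isSome_mono hkT hk.1] at hnone
      exact absurd hnone (by simp)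

theorem Computable.sum_range {g : ℕ → ℕ} (hg : Computable g) :
    Computable fun c => ∑ x ∈ Finset.range c, g x := by
  refine (Computable.nat_rec (f := fun s : ℕ => s) (g := fun _ => 0)
    (h := fun _ p => p.2 + g p.1) Computable.id (Computable.const 0) ?_).of_eq fun s => ?_
  · exact (Primrec.nat_add.to_comp.comp (Computable.snd.comp Computable.snd)
      (hg.comp (Computable.fst.comp Computable.snd))).to₂
  · induction s with
    | zero => rfl
    | succ s ih => rw [Finset.sum_range_succ, ← ih]

open Nat.Partrec in
theorem not_computable_cp : ¬ Computable (cp (blockFun haltEnum)) := by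
  intro hcp
  refine ComputablePred.halting_problem_not_re 0 ?_
  -- The sum test expresses that `T` is true, so `p c T` checks whether `T` certifies that `c` does
  -- not halt.
  let p : Code → ℕ → Bool := fun c T =>
    decide (∑ x ∈ Finset.range (stageLen (T + 1)), cp (blockFun haltEnum) x = stageLen (T + 1)) &&
      (decide (Encodable.encode c < haltEnum T) && !(Code.evaln T c 0).isSome)
  have hlen : Computable fun q : Code × ℕ => stageLen (q.2 + 1) :=
    (primrec_stageLen.comp (Primrec.succ.comp Primrec.snd)).to_comp
  have hp : Computable₂ p :=
    Primrec.and.to_comp.comp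
      (Primrec.eq.decide.to_comp.comp (hcp.sum_range.comp hlen) hlen)
      (Primrec.and.comp
        (Primrec.nat_lt.decide.comp (Primrec.encode.comp Primrec.fst)
          (primrec_haltEnum.comp Primrec.snd))
        (Primrec.not.comp primrec_evaln_isSome)).to_comp
  refine (Partrec.rfind hp.partrec₂).dom_re.of_eq fun c => ?_
  rw [not_halts_iff]
  have hdom : (Nat.rfind (fun T => Part.some (p c T) : ℕ →. Bool)).Dom ↔
      ∃ T, p c T = true := by
    refine Nat.rfind_dom'.trans ?_
    constructor
    · rintro ⟨T, hT, -⟩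
      exact ⟨T, (Part.mem_some_iff.1 hT).symm⟩
    · rintro ⟨T, hT⟩
      exact ⟨T, Part.mem_some_iff.2 hT.symm, fun _ => trivial⟩
  refine hdom.trans (exists_congr fun T => ?_)
  have hiff : IsTrueStage haltEnum T ↔ ∑ x ∈ Finset.range (stageLen (T + 1)),
      cp (blockFun haltEnum) x = stageLen (T + 1) := by
    rw [← isBlockFunction_blockFun.fClosed_Iio_iff_sum_cp fun i hi => blockFun_lt hi]
    exact ⟨fun hT => hT.fClosed, isTrueStage_of_fClosed⟩
  simp [p, hiff]

/-! ### Construction of a computable copy -/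

/-- The first of the two elements of the copy that code whether `n` belongs to the given set. The
second one is its successor. -/
def codeName (n : ℕ) : ℕ := 2 * stageLen n + 5

/-- The new position of an element that had position `i` before a stage at which `k` elements
are present. Everything from position `b` on is moved into a copy of `[0, k)`, except that for
`g ≠ 0` the elements at `b` and `b + 1` are moved to `k + g` and `k + g + 1`. -/
def oldPos (k b g i : ℕ) : ℕ :=
  if i < b then i else if g ≠ 0 ∧ i < b + 2 then k + g + (i - b) else k + 5 + i

/-- The position of the `j`-th new element, see `oldPos`. -/
def newPos (k b g j : ℕ) : ℕ :=
  if k + 5 ≤ j then k + j else if g ≠ 0 ∧ k + g ≤ b + j then b + j + 2 else b + j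

/-- The parameters `b` and `g` of `oldPos` at stage `s`, where `l` lists the positions before
stage `s` and `a n s` is the approximation at stage `s` to the coded set. -/
def shiftParam (h : ℕ → ℕ) (a : ℕ → ℕ → Bool) (s : ℕ) (l : List ℕ) : ℕ × ℕ :=
  bif !s.bodd && (decide (s.div2.unpair.1 < s) &&
      !decide (blockFun h (l.getD (codeName s.div2.unpair.1) 0) =
        l.getD (codeName s.div2.unpair.1) 0 + (a s.div2.unpair.1 s).toNat)) then
    (l.getD (codeName s.div2.unpair.1) 0, 1 + 2 * (a s.div2.unpair.1 s).toNat)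
  else (stageLen (target h s), 0)

/-- The positions of the elements `0, …, stageLen s - 1` of the copy before stage `s`. -/
def posList (h : ℕ → ℕ) (a : ℕ → ℕ → Bool) : ℕ → List ℕ
  | 0 => []
  | s + 1 =>
    (posList h a s).map (oldPos (stageLen s) (shiftParam h a s (posList h a s)).1
      (shiftParam h a s (posList h a s)).2) ++
    (List.range (stageLen s + 7)).map (newPos (stageLen s) (shiftParam h a s (posList h a s)).1
      (shiftParam h a s (posList h a s)).2)

/-- The position of `x` before stage `s`. -/
def pos (h : ℕ → ℕ) (a : ℕ → ℕ → Bool) (s x : ℕ) : ℕ := (posList h a s).getD x 0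

/-- The position from which on elements are moved at stage `s`. -/
def cut (h : ℕ → ℕ) (a : ℕ → ℕ → Bool) (s : ℕ) : ℕ := (shiftParam h a s (posList h a s)).1

/-- The offset of the pair to which the coding pair at `cut h a s` is moved, or zero. -/
def gadget (h : ℕ → ℕ) (a : ℕ → ℕ → Bool) (s : ℕ) : ℕ := (shiftParam h a s (posList h a s)).2

theorem oldPos_of_lt {k b g i : ℕ} (hi : i < b) : oldPos k b g i = i := by
  simp [oldPos, hi]

theorem oldPos_pair {k b g j : ℕ} (hg : g ≠ 0) (hj : j < 2) :
    oldPos k b g (b + j) = k + g + j := by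
  simp [oldPos, hg, hj]

theorem oldPos_of_le {k b g i : ℕ} (hb : b ≤ i) (hi : g ≠ 0 → b + 2 ≤ i) :
    oldPos k b g i = k + 5 + i := by
  rw [oldPos, if_neg (by omega), if_neg (by omega)]

theorem oldPos_lt {k b g i : ℕ} (hg : g ≤ 3) (hi : i < k) : oldPos k b g i < 2 * k + 5 := by
  unfold oldPos; split_ifs <;> omega

theorem oldPos_strictMono {k b g : ℕ} (hg : g ≤ 3) (hb : b ≤ k) : StrictMono (oldPos k b g) := by
  intro i j hij
  unfold oldPos; split_ifs <;> omega

theorem newPos_lt {k b g j : ℕ} (hb : b ≤ k) (hj : j < k + 7) :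
    newPos k b g j < 2 * k + 7 := by
  unfold newPos; split_ifs <;> omega

theorem newPos_strictMono {k b g : ℕ} (hb : b ≤ k) (hbg : g ≠ 0 → b + 2 ≤ k) :
    StrictMono (newPos k b g) := by
  intro i j hij
  unfold newPos; split_ifs <;> omega

theorem oldPos_ne_newPos {k b g i j : ℕ} (hg : g ≤ 3) (hi : i < k) :
    oldPos k b g i ≠ newPos k b g j := by
  unfold oldPos newPos; split_ifs <;> omega

/-! ### Invariants of the positions at finite stages -/

section Copy

variable {h : ℕ → ℕ} {a : ℕ → ℕ → Bool}

theorem length_posList (s : ℕ) : (posList h a s).length = stageLen s := by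
  induction s with
  | zero => rfl
  | succ s ih => simp [posList, ih, stageLen_succ]; omega

theorem pos_succ_of_lt {s x : ℕ} (hx : x < stageLen s) :
    pos h a (s + 1) x = oldPos (stageLen s) (cut h a s) (gadget h a s) (pos h a s x) := by
  rw [← length_posList (h := h) (a := a)] at hx
  rw [pos, posList, List.getD_append _ _ _ _ (by simpa using hx)]
  simp [pos, cut, gadget, hx]

theorem pos_succ_add {s j : ℕ} (hj : j < stageLen s + 7) :
    pos h a (s + 1) (stageLen s + j) =
      newPos (stageLen s) (cut h a s) (gadget h a s) j := by
  rw [pos, posList, List.getD_append_right _ _ _ _ (by simp [length_posList])]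
  simp [cut, gadget, length_posList, hj]

theorem codeName_lt {n s : ℕ} (hn : n < s) : codeName n + 1 < stageLen s := by
  have := strictMono_stageLen.monotone (show n + 1 ≤ s from hn)
  rw [stageLen_succ] at this
  rw [codeName]
  omega

theorem shiftParam_cases (s : ℕ) :
    (gadget h a s = 0 ∧ cut h a s = stageLen (target h s)) ∨
      ∃ n < s, s = 2 * s.div2 ∧ n = s.div2.unpair.1 ∧ cut h a s = pos h a s (codeName n) ∧
        gadget h a s = 1 + 2 * (a n s).toNat ∧
        blockFun h (pos h a s (codeName n)) ≠ pos h a s (codeName n) + (a n s).toNat := by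
  unfold gadget cut shiftParam
  rw [← pos]
  rcases hb : (!s.bodd && (decide (s.div2.unpair.1 < s) &&
      !decide (blockFun h (pos h a s (codeName s.div2.unpair.1)) =
        pos h a s (codeName s.div2.unpair.1) + (a s.div2.unpair.1 s).toNat)))
  · exact .inl ⟨rfl, rfl⟩
  · simp only [Bool.and_eq_true, Bool.not_eq_true', decide_eq_true_eq, decide_eq_false_iff_not]
      at hb
    refine .inr ⟨_, hb.2.1, ?_, rfl, rfl, rfl, hb.2.2⟩
    have := Nat.bodd_add_div2 s
    rw [hb.1] at this
    simpa using this.symm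

/-- The stages `2 * Nat.pair n j` attend to `n`, so each `n` is attended to infinitely often. -/
theorem gadget_ne_zero_of_ne {n j : ℕ} (hn : n < 2 * Nat.pair n j)
    (hv : blockFun h (pos h a (2 * Nat.pair n j) (codeName n)) ≠
      pos h a (2 * Nat.pair n j) (codeName n) + (a n (2 * Nat.pair n j)).toNat) :
    gadget h a (2 * Nat.pair n j) ≠ 0 := by
  unfold gadget shiftParam
  rw [← pos]
  simp [hn, hv]

/-- The pair `q`, `q + 1` is closed for the part of the block function built before stage `s`, and
no stage starts between its elements. -/
structure IsCodePos (h : ℕ → ℕ) (s q : ℕ) : Prop where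
  closed : ClosedAt h s q
  closed' : ClosedAt h s (q + 2)
  val : blockFun h q = q ∨ blockFun h q = q + 1
  val' : blockFun h (q + 1) = q + 1
  bd : ∀ t, stageLen t ≠ q + 1

/-- The facts about the positions before stage `s` that are preserved by the construction. -/
structure CopyInv (h : ℕ → ℕ) (a : ℕ → ℕ → Bool) (s : ℕ) : Prop where
  lt : ∀ x < stageLen s, pos h a s x < stageLen s
  inj : ∀ x < stageLen s, ∀ y < stageLen s, pos h a s x = pos h a s y → x = y
  adj : ∀ n < s, pos h a s (codeName n + 1) = pos h a s (codeName n) + 1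
  code : ∀ n < s, IsCodePos h s (pos h a s (codeName n))

/-- What the invariants imply about the shift at stage `s`. -/
structure ShiftSpec (h : ℕ → ℕ) (a : ℕ → ℕ → Bool) (s : ℕ) : Prop where
  cut_le : cut h a s ≤ stageLen s
  gadget_eq : gadget h a s = 0 ∨ gadget h a s = 1 ∨ gadget h a s = 3
  pair_le : gadget h a s ≠ 0 → cut h a s + 2 ≤ stageLen s
  cut_le_target : cut h a s ≤ stageLen (target h s)
  closed : ClosedAt h s (cut h a s)
  closed' : gadget h a s ≠ 0 → ClosedAt h s (cut h a s + 2)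
  val' : gadget h a s ≠ 0 → blockFun h (cut h a s + 1) = cut h a s + 1

theorem CopyInv.shiftSpec (hE : ∀ j, target h (2 * j) = 2 * j) {s : ℕ} (hs : CopyInv h a s) :
    ShiftSpec h a s := by
  rcases shiftParam_cases (h := h) (a := a) s with ⟨hg, hb⟩ | ⟨n, hn, he, -, hb, hg, -⟩
  · exact ⟨hb ▸ stageLen_target_le s, .inl hg, fun h0 => absurd hg h0, hb.le,
      hb ▸ closedAt_stageLen_target s, fun h0 => absurd hg h0, fun h0 => absurd hg h0⟩
  · have h1 := hs.lt _ (codeName_lt hn)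
    rw [hs.adj n hn] at h1
    have h2 := (a n s).toNat_le
    -- A coding stage is even, hence its target is `s` itself and the cut cannot lie beyond it.
    have h3 := hE s.div2
    rw [← he] at h3
    have hc := hs.code n hn
    rw [← hb] at hc
    exact ⟨by omega, by omega, fun _ => by omega, by rw [h3]; omega, hc.closed,
      fun _ => hc.closed', fun _ => hc.val'⟩

theorem ShiftSpec.gadget_le {s : ℕ} (hs : ShiftSpec h a s) : gadget h a s ≤ 3 := by
  have := hs.gadget_eq
  omega

/-- Moving elements preserves the block function except at a coding element that is changed. -/
theorem ShiftSpec.blockFun_oldPos {s i : ℕ} (hs : ShiftSpec h a s) (hi : i < stageLen s)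
    (hne : gadget h a s ≠ 0 → i ≠ cut h a s) :
    blockFun h (oldPos (stageLen s) (cut h a s) (gadget h a s) i) =
      oldPos (stageLen s) (cut h a s) (gadget h a s) (blockFun h i) := by
  have hc := hs.closed i hi
  rcases lt_or_ge i (cut h a s) with hib | hib
  · rw [oldPos_of_lt hib, oldPos_of_lt (hc.1 hib)]
  · have hFb : cut h a s ≤ blockFun h i := by omega
    by_cases hpair : gadget h a s ≠ 0 ∧ i = cut h a s + 1
    · obtain ⟨hg, rfl⟩ := hpair
      rw [hs.val' hg, oldPos_pair hg one_lt_two]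
      rcases hs.gadget_eq with h0 | h1 | h3
      · exact absurd h0 hg
      · rw [h1]; exact blockFun_add_two s
      · rw [h3]; exact blockFun_add_four s
    · have hib2 : gadget h a s ≠ 0 → cut h a s + 2 ≤ i := fun hg => by
        have := hne hg
        have : ¬ i = cut h a s + 1 := fun hi => hpair ⟨hg, hi⟩
        omega
      have hFb2 : gadget h a s ≠ 0 → cut h a s + 2 ≤ blockFun h i := fun hg => by
        have := hs.closed' hg i hi
        have := hib2 hg
        omega
      rw [oldPos_of_le hib hib2, oldPos_of_le hFb hFb2, blockFun_copy hi]

theorem stageLen_ne {s m : ℕ} (h1 : stageLen s < m) (h2 : m < stageLen (s + 1)) (t : ℕ) :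
    stageLen t ≠ m := by
  rintro rfl
  rw [strictMono_stageLen.lt_iff_lt] at h1 h2
  omega

theorem IsCodePos.of_le {s q : ℕ} (hq : IsCodePos h s q) (hle : q + 2 ≤ stageLen (target h s)) :
    IsCodePos h (s + 1) q :=
  ⟨hq.closed.succ (by omega), hq.closed'.succ hle, hq.val, hq.val', hq.bd⟩

theorem IsCodePos.copy {s q : ℕ} (hq : IsCodePos h s q) (hlt : q + 1 < stageLen s) :
    IsCodePos h (s + 1) (stageLen s + 5 + q) := by
  refine ⟨hq.closed.copy, hq.closed'.copy, ?_, ?_, stageLen_ne (s := s) (by omega)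
    (by rw [stageLen_succ]; omega)⟩
  · have := hq.val
    rw [blockFun_copy (by omega)]
    omega
  · have := hq.val'
    rw [add_assoc, blockFun_copy hlt]
    omega

theorem isCodePos_gadget {s g : ℕ} (hg : g = 1 ∨ g = 3) :
    IsCodePos h (s + 1) (stageLen s + g) := by
  refine ⟨closedAt_add hg, ?_, ?_, ?_, stageLen_ne (s := s) (by omega)
    (by rw [stageLen_succ]; omega)⟩
  · rcases hg with rfl | rfl
    · exact closedAt_add (.inr rfl)
    · exact ClosedAt.copy (q := 0) fun i _ => by simp
  · rcases hg with rfl | rfl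
    · exact .inl (blockFun_add_one s)
    · exact .inr (blockFun_add_three s)
  · rcases hg with rfl | rfl
    · exact blockFun_add_two s
    · exact blockFun_add_four s

theorem isCodePos_last (s : ℕ) : IsCodePos h (s + 1) (2 * stageLen s + 5) := by
  refine ⟨?_, closedAt_of_le le_rfl, .inl (blockFun_last (j := 0) two_pos),
    blockFun_last one_lt_two, stageLen_ne (s := s) (by omega) (by rw [stageLen_succ]; omega)⟩
  have := ClosedAt.copy (closedAt_of_le (h := h) (le_refl (stageLen s)))
  rwa [show stageLen s + 5 + stageLen s = 2 * stageLen s + 5 by ring] at this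

theorem codeName_odd (n : ℕ) : codeName n % 2 = 1 := by
  rw [codeName]
  omega

/-- No cut separates a coding pair. An ordinary cut is a stage boundary, excluded by `bd`; a coding
cut begins a pair, and distinct pairs are disjoint because their first names are odd. -/
theorem CopyInv.position_cases {s n : ℕ} (hs : CopyInv h a s) (hn : n < s) :
    pos h a s (codeName n) + 2 ≤ cut h a s ∨
      (gadget h a s ≠ 0 ∧ pos h a s (codeName n) = cut h a s) ∨
      (cut h a s ≤ pos h a s (codeName n) ∧
        (gadget h a s ≠ 0 → cut h a s + 2 ≤ pos h a s (codeName n))) := by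
  have h1 := codeName_lt hn
  have h2 := codeName_odd n
  rcases shiftParam_cases (h := h) (a := a) s with ⟨hg, hb⟩ | ⟨m, hm, -, -, hb, hg, -⟩
  · have := (hs.code n hn).bd (target h s)
    omega
  · have h3 := codeName_lt hm
    have h4 := codeName_odd m
    have h5 : pos h a s (codeName n) + 1 ≠ pos h a s (codeName m) := fun heq => by
      rw [← hs.adj n hn] at heq
      have := hs.inj _ h1 _ (by omega) heq
      omega
    have h6 : pos h a s (codeName n) ≠ pos h a s (codeName m) + 1 := fun heq => by
      rw [← hs.adj m hm] at heq
      have := hs.inj _ (by omega) _ h3 heq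
      omega
    omega

theorem pos_succ_codeName (s : ℕ) {j : ℕ} (hj : j < 2) :
    pos h a (s + 1) (codeName s + j) = 2 * stageLen s + 5 + j := by
  rw [codeName, show 2 * stageLen s + 5 + j = stageLen s + (stageLen s + 5 + j) by ring,
    pos_succ_add (by omega), newPos, if_pos (by omega)]

theorem CopyInv.succ (hE : ∀ j, target h (2 * j) = 2 * j) {s : ℕ} (hs : CopyInv h a s) :
    CopyInv h a (s + 1) := by
  have hsp := hs.shiftSpec hE
  have hcases : ∀ x < stageLen (s + 1), x < stageLen s ∨
      ∃ j < stageLen s + 7, x = stageLen s + j := fun x hx => by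
    rw [stageLen_succ] at hx
    rcases lt_or_ge x (stageLen s) with h1 | h1
    · exact .inl h1
    · exact .inr ⟨x - stageLen s, by omega, by omega⟩
  have hmono := oldPos_strictMono hsp.gadget_le hsp.cut_le
  have hmono' := newPos_strictMono (g := gadget h a s) hsp.cut_le hsp.pair_le
  have hq : ∀ n < s, pos h a (s + 1) (codeName n + 1) = pos h a (s + 1) (codeName n) + 1 ∧
      IsCodePos h (s + 1) (pos h a (s + 1) (codeName n)) := fun n hn => by
    have h1 := codeName_lt hn
    have h2 := hs.lt _ h1
    have hc := hs.code n hn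
    have htar := hsp.cut_le_target
    rw [pos_succ_of_lt h1, pos_succ_of_lt (by omega), hs.adj n hn]
    rw [hs.adj n hn] at h2
    rcases hs.position_cases hn with h3 | ⟨hg, h3⟩ | ⟨h3, h4⟩
    · rw [oldPos_of_lt (by omega), oldPos_of_lt (by omega)]
      exact ⟨rfl, hc.of_le (by omega)⟩
    · have h5 := oldPos_pair (k := stageLen s) (b := cut h a s) hg two_pos
      rw [add_zero, add_zero] at h5
      rw [h3, oldPos_pair hg one_lt_two, h5]
      exact ⟨rfl, isCodePos_gadget (hsp.gadget_eq.resolve_left hg)⟩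
    · rw [oldPos_of_le (by omega) (by omega), oldPos_of_le h3 h4]
      exact ⟨rfl, hc.copy h2⟩
  refine ⟨fun x hx => ?_, fun x hx y hy hxy => ?_, fun n hn => ?_, fun n hn => ?_⟩
  · rw [stageLen_succ]
    rcases hcases x hx with hx | ⟨j, hj, rfl⟩
    · rw [pos_succ_of_lt hx]
      exact (oldPos_lt hsp.gadget_le (hs.lt x hx)).trans (by omega)
    · rw [pos_succ_add hj]
      exact newPos_lt hsp.cut_le hj
  · rcases hcases x hx with hx | ⟨i, hi, rfl⟩ <;> rcases hcases y hy with hy | ⟨j, hj, rfl⟩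
    · rw [pos_succ_of_lt hx, pos_succ_of_lt hy] at hxy
      exact hs.inj x hx y hy (hmono.injective hxy)
    · rw [pos_succ_of_lt hx, pos_succ_add hj] at hxy
      exact absurd hxy (oldPos_ne_newPos hsp.gadget_le (hs.lt x hx))
    · rw [pos_succ_of_lt hy, pos_succ_add hi] at hxy
      exact absurd hxy.symm (oldPos_ne_newPos hsp.gadget_le (hs.lt y hy))
    · rw [pos_succ_add hi, pos_succ_add hj] at hxy
      rw [hmono'.injective hxy]
  · rcases Nat.lt_succ_iff_lt_or_eq.1 hn with hn | rfl
    · exact (hq n hn).1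
    · rw [pos_succ_codeName n one_lt_two]
      exact congrArg (· + 1) (pos_succ_codeName n two_pos).symm
  · rcases Nat.lt_succ_iff_lt_or_eq.1 hn with hn | rfl
    · exact (hq n hn).2
    · have := pos_succ_codeName (h := h) (a := a) n two_pos
      rw [add_zero, add_zero] at this
      rw [this]
      exact isCodePos_last n

theorem copyInv (hE : ∀ j, target h (2 * j) = 2 * j) (s : ℕ) : CopyInv h a s := by
  induction s with
  | zero => constructor <;> simp [stageLen]
  | succ s ih => exact ih.succ hE

end Copy

/-! ### The limit of the construction -/

section Limit

variable {h : ℕ → ℕ} {a : ℕ → ℕ → Bool} {A : ℕ → Bool}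

theorem pos_lt_pos_succ_iff (hE : ∀ j, target h (2 * j) = 2 * j) {s x y : ℕ}
    (hx : x < stageLen s) (hy : y < stageLen s) :
    pos h a (s + 1) x < pos h a (s + 1) y ↔ pos h a s x < pos h a s y := by
  have hsp := (copyInv (a := a) hE s).shiftSpec hE
  rw [pos_succ_of_lt hx, pos_succ_of_lt hy,
    (oldPos_strictMono hsp.gadget_le hsp.cut_le).lt_iff_lt]

theorem pos_lt_pos_iff (hE : ∀ j, target h (2 * j) = 2 * j) {s t x y : ℕ} (hst : s ≤ t)
    (hx : x < stageLen s) (hy : y < stageLen s) :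
    pos h a t x < pos h a t y ↔ pos h a s x < pos h a s y := by
  induction t, hst using Nat.le_induction with
  | base => rfl
  | succ t hst ih =>
    have := strictMono_stageLen.monotone hst
    rw [pos_lt_pos_succ_iff hE (hx.trans_le this) (hy.trans_le this), ih]

/-- The pair of `m` is created to the right of all names then present, and order is preserved.
Coding `m` therefore never moves a name below `stageLen m`. -/
theorem pos_lt_pos_codeName (hE : ∀ j, target h (2 * j) = 2 * j) {s m x : ℕ} (hms : m < s)
    (hx : x < stageLen m) : pos h a s x < pos h a s (codeName m) := by
  have hsp := (copyInv (a := a) hE m).shiftSpec hE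
  rw [pos_lt_pos_iff hE (s := m + 1) hms (hx.trans (strictMono_stageLen m.lt_succ_self))
    (by have := codeName_lt (show m < m + 1 by omega); omega), pos_succ_of_lt hx]
  have := pos_succ_codeName (h := h) (a := a) m two_pos
  rw [add_zero, add_zero] at this
  rw [this]
  exact oldPos_lt hsp.gadget_le ((copyInv hE m).lt x hx)

/-- The value at a coding element changes only when the approximation requires it. -/
theorem blockFun_codeName_succ (hE : ∀ j, target h (2 * j) = 2 * j) {s n v : ℕ} (hn : n < s)
    (hv : blockFun h (pos h a s (codeName n)) = pos h a s (codeName n) + v)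
    (hne : gadget h a s ≠ 0 → pos h a s (codeName n) ≠ cut h a s) :
    blockFun h (pos h a (s + 1) (codeName n)) = pos h a (s + 1) (codeName n) + v := by
  have hs := copyInv (a := a) hE s
  have h1 := codeName_lt hn
  have hlt := hs.lt _ (show codeName n < stageLen s by omega)
  have hadj := (copyInv (a := a) hE (s + 1)).adj n (by omega)
  have hval := (hs.code n hn).val
  rw [pos_succ_of_lt h1, hs.adj n hn, pos_succ_of_lt (by omega)] at hadj
  rw [pos_succ_of_lt (by omega), (hs.shiftSpec hE).blockFun_oldPos hlt hne, hv]
  obtain rfl | rfl : v = 0 ∨ v = 1 := by omega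
  · rfl
  · exact hadj

/-- Once the approximation at `n` is constant, a correct pair is never again chosen as the cut pair,
and a wrong one is corrected at the next even stage that attends to it. -/
theorem exists_code_settled (hE : ∀ j, target h (2 * j) = 2 * j)
    (hA : ∀ n, ∃ s₀, ∀ s, s₀ ≤ s → a n s = A n) (n : ℕ) :
    ∃ s₁, ∀ s, s₁ ≤ s → n < s ∧ a n s = A n ∧
      blockFun h (pos h a s (codeName n)) = pos h a s (codeName n) + (A n).toNat := by
  obtain ⟨s₀, hs₀⟩ := hA n
  have key : ∀ s, s₀ ≤ s → n < s →
      blockFun h (pos h a s (codeName n)) = pos h a s (codeName n) + (A n).toNat →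
      blockFun h (pos h a (s + 1) (codeName n)) =
        pos h a (s + 1) (codeName n) + (A n).toNat := by
    intro s hs hn hv
    refine blockFun_codeName_succ hE hn hv fun hg heq => ?_
    rcases shiftParam_cases (h := h) (a := a) s with ⟨hg', -⟩ | ⟨m, hm, -, -, hb, -, hval⟩
    · exact hg hg'
    · have h1 := codeName_lt hn
      have h2 := codeName_lt hm
      have h3 := (copyInv (a := a) hE s).inj _ (by omega) _ (by omega) (heq.trans hb)
      obtain rfl : n = m := by
        refine strictMono_stageLen.injective ?_
        rw [codeName, codeName] at h3
        omega
      exact hval (hs₀ s hs ▸ hv)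
  obtain ⟨s₁, hs₁, hn₁, hv₁⟩ : ∃ s₁, s₀ ≤ s₁ ∧ n < s₁ ∧
      blockFun h (pos h a s₁ (codeName n)) = pos h a s₁ (codeName n) + (A n).toNat := by
    -- The second component is chosen large so that this stage lies beyond both `s₀` and `n`.
    have hj := Nat.right_le_pair n (s₀ + n + 1)
    set s := 2 * Nat.pair n (s₀ + n + 1) with hsdef
    by_cases hv : blockFun h (pos h a s (codeName n)) =
        pos h a s (codeName n) + (A n).toNat
    · exact ⟨s, by omega, by omega, hv⟩
    · have hg : gadget h a s ≠ 0 :=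
        gadget_ne_zero_of_ne (by omega) (by rw [← hsdef, hs₀ s (by omega)]; exact hv)
      refine ⟨s + 1, by omega, by omega, ?_⟩
      rcases shiftParam_cases (h := h) (a := a) s with ⟨hg', -⟩ | ⟨m, hm, hse, hms, hb, hg', -⟩
      · exact absurd hg' hg
      · have hdiv : s.div2 = Nat.pair n (s₀ + n + 1) := by omega
        rw [hdiv, Nat.unpair_pair] at hms
        subst hms
        have h1 := codeName_lt hm
        have h2 := oldPos_pair (k := stageLen s) (b := cut h a s) hg two_pos
        rw [add_zero, add_zero] at h2
        rw [pos_succ_of_lt (by omega), ← hb, h2, hg', hs₀ s (by omega)]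
        cases A m
        · exact blockFun_add_one s
        · exact blockFun_add_three s
  refine ⟨s₁, fun s hs => ?_⟩
  induction s, hs using Nat.le_induction with
  | base => exact ⟨hn₁, hs₀ _ hs₁, hv₁⟩
  | succ s hs ih => exact ⟨by omega, hs₀ _ (by omega), key s (by omega) ih.1 ih.2.2⟩

/-- Each element is eventually to the left of all the movements. -/
theorem exists_forall_pos_lt_cut (hE : ∀ j, target h (2 * j) = 2 * j)
    (hA : ∀ n, ∃ s₀, ∀ s, s₀ ≤ s → a n s = A n) (x : ℕ) :
    ∃ S, ∀ s, S ≤ s → x < stageLen s ∧ pos h a s x < cut h a s := by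
  choose s₁ hs₁ using exists_code_settled hE hA
  -- Beyond `T` all pairs with index at most `x` are settled, and no merge reaches back before
  -- `stageLen (T + 1)`.
  obtain ⟨T, hNT, hT⟩ := exists_isTrueStage (h := h) (∑ n ∈ Finset.range (x + 1), s₁ n + x)
  refine ⟨T + 1, ?_⟩
  suffices H : ∀ s, T + 1 ≤ s → pos h a s x < stageLen (T + 1) ∧ pos h a s x < cut h a s from
    fun s hs => ⟨by have := le_stageLen s; omega, (H s hs).2⟩
  have hstep : ∀ s, T + 1 ≤ s → pos h a s x < stageLen (T + 1) → pos h a s x < cut h a s := by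
    intro s hs hlt
    rcases shiftParam_cases (h := h) (a := a) s with ⟨-, hb⟩ | ⟨m, hm, -, -, hb, -, hval⟩
    · rw [hb]
      exact hlt.trans_le (strictMono_stageLen.monotone (hT.lt_target hs))
    · rw [hb]
      -- A pair coded at this stage is unsettled, so its index exceeds `x` and it lies to the right
      -- of `x`.
      refine pos_lt_pos_codeName hE hm (lt_of_lt_of_le ?_ (le_stageLen m))
      by_contra! hmx
      have h1 : s₁ m ≤ ∑ n ∈ Finset.range (x + 1), s₁ n :=
        Finset.single_le_sum (f := s₁) (fun _ _ => Nat.zero_le _)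
          (Finset.mem_range.2 (Nat.lt_succ_of_le hmx))
      obtain ⟨-, h2, h3⟩ := hs₁ m s (by omega)
      exact hval (h2 ▸ h3)
  intro s hs
  induction s, hs using Nat.le_induction with
  | base =>
    have h1 := (copyInv (a := a) hE (T + 1)).lt x (by have := le_stageLen (T + 1); omega)
    exact ⟨h1, hstep _ le_rfl h1⟩
  | succ s hs ih =>
    have h1 : pos h a (s + 1) x < stageLen (T + 1) := by
      rw [pos_succ_of_lt (by have := le_stageLen s; omega), oldPos_of_lt ih.2]
      exact ih.1
    exact ⟨h1, hstep _ (by omega) h1⟩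

theorem exists_limit (hE : ∀ j, target h (2 * j) = 2 * j)
    (hA : ∀ n, ∃ s₀, ∀ s, s₀ ≤ s → a n s = A n) (x : ℕ) :
    ∃ p S, ∀ s, S ≤ s → pos h a s x = p ∧ x < stageLen s ∧ p < cut h a s := by
  obtain ⟨S, hS⟩ := exists_forall_pos_lt_cut hE hA x
  refine ⟨pos h a S x, S, fun s hs => ?_⟩
  have : pos h a s x = pos h a S x := by
    induction s, hs using Nat.le_induction with
    | base => rfl
    | succ s hs ih =>
      obtain ⟨h1, h2⟩ := hS s hs
      rw [pos_succ_of_lt h1, oldPos_of_lt h2, ih]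
  exact ⟨this, this ▸ hS s hs⟩

/-- The relation that orders the elements of the copy. -/
def copyLT (h : ℕ → ℕ) (a : ℕ → ℕ → Bool) (x y : ℕ) : Prop :=
  pos h a (x + y + 1) x < pos h a (x + y + 1) y

theorem exists_pos_eq (hE : ∀ j, target h (2 * j) = 2 * j) {s p : ℕ} (hp : p < stageLen s) :
    ∃ x < stageLen s, pos h a s x = p := by
  have hs := copyInv (a := a) hE s
  have := Finset.surjOn_of_injOn_of_card_le (s := Finset.range (stageLen s))
    (t := Finset.range (stageLen s)) (pos h a s)
    (fun x hx => by simpa using hs.lt x (by simpa using hx))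
    (fun x hx y hy => hs.inj x (by simpa using hx) y (by simpa using hy)) le_rfl
  obtain ⟨x, hx, hxp⟩ := this (show p ∈ ((Finset.range (stageLen s) : Finset ℕ) : Set ℕ) by
    simpa using hp)
  exact ⟨x, by simpa using hx, hxp⟩

/-- The positions converge to an isomorphism of the copy onto `(ω, <)`. -/
theorem exists_limit_equiv (hE : ∀ j, target h (2 * j) = 2 * j)
    (hA : ∀ n, ∃ s₀, ∀ s, s₀ ≤ s → a n s = A n) :
    ∃ φ : ℕ ≃ ℕ, (∀ x, ∃ S, ∀ s, S ≤ s → pos h a s x = φ x ∧ x < stageLen s) ∧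
      ∀ x y, copyLT h a x y ↔ φ x < φ y := by
  choose φ S hS using exists_limit hE hA
  have hinj : Function.Injective φ := fun x y hxy => by
    obtain ⟨h1, h2, -⟩ := hS x (S x + S y) (by omega)
    obtain ⟨h3, h4, -⟩ := hS y (S x + S y) (by omega)
    exact (copyInv hE _).inj x h2 y h4 (by rw [h1, h3, hxy])
  have hsurj : Function.Surjective φ := fun p => by
    -- Once some `x` has settled at a position beyond `p`, all cuts lie beyond `p` too, so the name
    -- then at `p` stays there.
    obtain ⟨_, ⟨x, rfl⟩, hpx⟩ := (Set.infinite_range_of_injective hinj).exists_gt p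
    obtain ⟨h1, h2, -⟩ := hS x (S x) le_rfl
    have h3 := (copyInv (a := a) hE (S x)).lt x h2
    obtain ⟨y, hy, hyp⟩ := exists_pos_eq (a := a) hE (show p < stageLen (S x) by omega)
    have hyp' : ∀ s, S x ≤ s → pos h a s y = p := fun s hs => by
      induction s, hs using Nat.le_induction with
      | base => exact hyp
      | succ s hs ih =>
        have h4 := (hS x s hs).2.2
        rw [pos_succ_of_lt (hy.trans_le (strictMono_stageLen.monotone hs)),
          oldPos_of_lt (by omega), ih]
    refine ⟨y, ?_⟩
    rw [← (hS y (S x + S y) (by omega)).1, hyp' _ (by omega)]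
  refine ⟨Equiv.ofBijective φ ⟨hinj, hsurj⟩, fun x => ⟨S x, fun s hs =>
    ⟨(hS x s hs).1, (hS x s hs).2.1⟩⟩, fun x y => ?_⟩
  have h1 := le_stageLen (x + y + 1)
  rw [copyLT, ← pos_lt_pos_iff hE (t := x + y + 1 + S x + S y) (by omega) (by omega) (by omega),
    (hS x _ (by omega)).1, (hS y _ (by omega)).1]
  rfl

theorem blockFun_pos_eq_succ_iff (hE : ∀ j, target h (2 * j) = 2 * j) {s x y : ℕ}
    (hx : x < stageLen s) (hy : y < stageLen s) (hne : ∀ n, x ≠ codeName n) :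
    blockFun h (pos h a (s + 1) x) = pos h a (s + 1) y ↔
      blockFun h (pos h a s x) = pos h a s y := by
  have hs := copyInv (a := a) hE s
  have hsp := hs.shiftSpec hE
  rw [pos_succ_of_lt hx, pos_succ_of_lt hy, hsp.blockFun_oldPos (hs.lt x hx),
    (oldPos_strictMono hsp.gadget_le hsp.cut_le).injective.eq_iff]
  intro hg heq
  rcases shiftParam_cases (h := h) (a := a) s with ⟨hg', -⟩ | ⟨m, hm, -, -, hb, -, -⟩
  · exact hg hg'
  · exact hne m (hs.inj x hx _ (by have := codeName_lt hm; omega) (heq.trans hb))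

theorem blockFun_pos_eq_iff (hE : ∀ j, target h (2 * j) = 2 * j) {s t x y : ℕ} (hst : s ≤ t)
    (hx : x < stageLen s) (hy : y < stageLen s) (hne : ∀ n, x ≠ codeName n) :
    blockFun h (pos h a t x) = pos h a t y ↔ blockFun h (pos h a s x) = pos h a s y := by
  induction t, hst using Nat.le_induction with
  | base => rfl
  | succ t hst ih =>
    have := strictMono_stageLen.monotone hst
    rw [blockFun_pos_eq_succ_iff hE (hx.trans_le this) (hy.trans_le this) hne, ih]

/-- The value of the block function, transported to the copy, at the coding element of `n`. -/
theorem limit_codeName (hE : ∀ j, target h (2 * j) = 2 * j)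
    (hA : ∀ n, ∃ s₀, ∀ s, s₀ ≤ s → a n s = A n) {φ : ℕ ≃ ℕ}
    (hφ : ∀ x, ∃ S, ∀ s, S ≤ s → pos h a s x = φ x ∧ x < stageLen s) (n y : ℕ) :
    blockFun h (φ (codeName n)) = φ y ↔ y = codeName n + (A n).toNat := by
  obtain ⟨S, hS⟩ := hφ (codeName n)
  obtain ⟨S', hS'⟩ := hφ (codeName n + 1)
  obtain ⟨s₁, hs₁⟩ := exists_code_settled hE hA n
  obtain ⟨h1, -⟩ := hS (S + S' + s₁) (by omega)
  obtain ⟨h2, -⟩ := hS' (S + S' + s₁) (by omega)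
  obtain ⟨hn, -, hv⟩ := hs₁ (S + S' + s₁) (by omega)
  have hadj := (copyInv (a := a) hE (S + S' + s₁)).adj n hn
  rw [h1] at hv hadj
  rw [h2] at hadj
  rw [hv]
  cases A n
  · exact ⟨fun heq => (φ.injective heq).symm, fun heq => heq ▸ rfl⟩
  · rw [Bool.toNat_true, ← hadj, φ.injective.eq_iff, eq_comm]

/-- Off the first elements of coding pairs no move changes the relation, so the transported graph is
computable there. -/
theorem limit_of_ne_codeName (hE : ∀ j, target h (2 * j) = 2 * j) {φ : ℕ ≃ ℕ}
    (hφ : ∀ x, ∃ S, ∀ s, S ≤ s → pos h a s x = φ x ∧ x < stageLen s) {x : ℕ}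
    (hne : ∀ n, x ≠ codeName n) (y : ℕ) :
    blockFun h (φ x) = φ y ↔
      blockFun h (pos h a (x + y + 1) x) = pos h a (x + y + 1) y := by
  obtain ⟨S, hS⟩ := hφ x
  obtain ⟨S', hS'⟩ := hφ y
  have h1 := le_stageLen (x + y + 1)
  rw [← blockFun_pos_eq_iff hE (t := x + y + 1 + S + S') (by omega) (by omega) (by omega) hne,
    (hS _ (by omega)).1, (hS' _ (by omega)).1]

end Limit

/-! ### Computability of the copy -/

theorem primrec_oldPos : Primrec₂ fun (c : ℕ × ℕ × ℕ) (i : ℕ) => oldPos c.1 c.2.1 c.2.2 i := by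
  have hk : Primrec fun p : (ℕ × ℕ × ℕ) × ℕ => p.1.1 := Primrec.fst.comp Primrec.fst
  have hb : Primrec fun p : (ℕ × ℕ × ℕ) × ℕ => p.1.2.1 :=
    Primrec.fst.comp (Primrec.snd.comp Primrec.fst)
  have hg : Primrec fun p : (ℕ × ℕ × ℕ) × ℕ => p.1.2.2 :=
    Primrec.snd.comp (Primrec.snd.comp Primrec.fst)
  have hi : Primrec fun p : (ℕ × ℕ × ℕ) × ℕ => p.2 := Primrec.snd
  exact Primrec.ite (Primrec.nat_lt.comp hi hb) hi
    (Primrec.ite ((Primrec.eq.comp hg (Primrec.const 0)).not.and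
        (Primrec.nat_lt.comp hi (Primrec.nat_add.comp hb (Primrec.const 2))))
      (Primrec.nat_add.comp (Primrec.nat_add.comp hk hg) (Primrec.nat_sub.comp hi hb))
      (Primrec.nat_add.comp (Primrec.nat_add.comp hk (Primrec.const 5)) hi))

theorem primrec_newPos : Primrec₂ fun (c : ℕ × ℕ × ℕ) (i : ℕ) => newPos c.1 c.2.1 c.2.2 i := by
  have hk : Primrec fun p : (ℕ × ℕ × ℕ) × ℕ => p.1.1 := Primrec.fst.comp Primrec.fst
  have hb : Primrec fun p : (ℕ × ℕ × ℕ) × ℕ => p.1.2.1 :=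
    Primrec.fst.comp (Primrec.snd.comp Primrec.fst)
  have hg : Primrec fun p : (ℕ × ℕ × ℕ) × ℕ => p.1.2.2 :=
    Primrec.snd.comp (Primrec.snd.comp Primrec.fst)
  have hi : Primrec fun p : (ℕ × ℕ × ℕ) × ℕ => p.2 := Primrec.snd
  exact Primrec.ite (Primrec.nat_le.comp (Primrec.nat_add.comp hk (Primrec.const 5)) hi)
    (Primrec.nat_add.comp hk hi)
    (Primrec.ite ((Primrec.eq.comp hg (Primrec.const 0)).not.and
        (Primrec.nat_le.comp (Primrec.nat_add.comp hk hg) (Primrec.nat_add.comp hb hi)))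
      (Primrec.nat_add.comp (Primrec.nat_add.comp hb hi) (Primrec.const 2))
      (Primrec.nat_add.comp hb hi))

theorem primrec_codeName : Primrec codeName :=
  Primrec.nat_add.comp (Primrec.nat_mul.comp (Primrec.const 2) primrec_stageLen) (Primrec.const 5)

theorem computable_shiftParam {h : ℕ → ℕ} {a : ℕ → ℕ → Bool} (hh : Primrec h)
    (ha : Computable₂ a) : Computable₂ (shiftParam h a) := by
  have hs : Computable fun p : ℕ × List ℕ => p.1 := Computable.fst
  have hn : Computable fun p : ℕ × List ℕ => p.1.div2.unpair.1 :=
    (Primrec.fst.comp (Primrec.unpair.comp (Primrec.nat_div2.comp Primrec.fst))).to_comp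
  have hq : Computable fun p : ℕ × List ℕ => p.2.getD (codeName p.1.div2.unpair.1) 0 :=
    (Primrec.list_getD 0).to_comp.comp Computable.snd (primrec_codeName.to_comp.comp hn)
  have hv : Computable fun p : ℕ × List ℕ => (a p.1.div2.unpair.1 p.1).toNat :=
    (Primrec.dom_bool Bool.toNat).to_comp.comp (ha.comp hn hs)
  refine Computable.cond ?_ (Computable.pair hq ?_)
    (Computable.pair ((primrec_stageLen.comp (primrec_target hh)).to_comp.comp hs)
      (Computable.const 0))
  · exact Primrec.and.to_comp.comp (Primrec.not.to_comp.comp (Primrec.nat_bodd.to_comp.comp hs))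
      (Primrec.and.to_comp.comp (Primrec.nat_lt.decide.to_comp.comp hn hs)
        (Primrec.not.to_comp.comp (Primrec.eq.decide.to_comp.comp
          ((primrec_blockFun hh).to_comp.comp hq) (Primrec.nat_add.to_comp.comp hq hv))))
  · exact Primrec.nat_add.to_comp.comp (Computable.const 1)
      (Primrec.nat_mul.to_comp.comp (Computable.const 2) hv)

theorem computable_posList {h : ℕ → ℕ} {a : ℕ → ℕ → Bool} (hh : Primrec h)
    (ha : Computable₂ a) : Computable (posList h a) := by
  let step : (ℕ × ℕ × ℕ) × List ℕ → List ℕ := fun p =>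
    p.2.map (fun i => oldPos p.1.1 p.1.2.1 p.1.2.2 i) ++
      (List.range (p.1.1 + 7)).map (fun i => newPos p.1.1 p.1.2.1 p.1.2.2 i)
  have hstep : Primrec step := by
    have h1 : Primrec₂ fun (p : (ℕ × ℕ × ℕ) × List ℕ) (i : ℕ) =>
        oldPos p.1.1 p.1.2.1 p.1.2.2 i :=
      primrec_oldPos.comp (Primrec.fst.comp Primrec.fst) Primrec.snd
    have h2 : Primrec₂ fun (p : (ℕ × ℕ × ℕ) × List ℕ) (i : ℕ) =>
        newPos p.1.1 p.1.2.1 p.1.2.2 i :=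
      primrec_newPos.comp (Primrec.fst.comp Primrec.fst) Primrec.snd
    have h3 : Primrec fun p : (ℕ × ℕ × ℕ) × List ℕ => List.range (p.1.1 + 7) :=
      Primrec.list_range.comp (Primrec.nat_add.comp (Primrec.fst.comp Primrec.fst)
        (Primrec.const 7))
    exact Primrec.list_append.comp (Primrec.list_map Primrec.snd h1) (Primrec.list_map h3 h2)
  refine (Computable.nat_rec (f := fun s : ℕ => s) (g := fun _ => ([] : List ℕ))
    (h := fun _ p => step ((stageLen p.1, shiftParam h a p.1 p.2), p.2))
    Computable.id (Computable.const []) ?_).of_eq fun s => ?_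
  · have h1 : Computable fun q : ℕ × ℕ × List ℕ => q.2.1 := Computable.fst.comp Computable.snd
    have h2 : Computable fun q : ℕ × ℕ × List ℕ => q.2.2 := Computable.snd.comp Computable.snd
    have h3 : Computable fun q : ℕ × ℕ × List ℕ => shiftParam h a q.2.1 q.2.2 :=
      (computable_shiftParam hh ha).comp h1 h2
    have h4 : Computable fun q : ℕ × ℕ × List ℕ => stageLen q.2.1 :=
      primrec_stageLen.to_comp.comp h1
    exact hstep.to_comp.comp (Computable.pair (Computable.pair h4 h3) h2)
  · induction s with
    | zero => rfl
    | succ s ih => rw [posList, ← ih]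

theorem computable_pos {h : ℕ → ℕ} {a : ℕ → ℕ → Bool} (hh : Primrec h)
    (ha : Computable₂ a) : Computable₂ (pos h a) :=
  (Primrec.list_getD 0).to_comp.comp ((computable_posList hh ha).comp Computable.fst) Computable.snd

theorem computablePred_of_decide {α : Type*} [Primcodable α] {p : α → Prop} [DecidablePred p]
    (hp : Computable fun x => decide (p x)) : ComputablePred p :=
  ⟨inferInstance, hp⟩

theorem computable_pos_pair {h : ℕ → ℕ} {a : ℕ → ℕ → Bool} (hh : Primrec h)
    (ha : Computable₂ a) :
    Computable (fun p : ℕ × ℕ => pos h a (p.1 + p.2 + 1) p.1) ∧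
      Computable (fun p : ℕ × ℕ => pos h a (p.1 + p.2 + 1) p.2) := by
  have hs : Computable fun p : ℕ × ℕ => p.1 + p.2 + 1 :=
    (Primrec.succ.comp Primrec.nat_add).to_comp
  exact ⟨(computable_pos hh ha).comp hs Computable.fst,
    (computable_pos hh ha).comp hs Computable.snd⟩

theorem computablePred_copyLT {h : ℕ → ℕ} {a : ℕ → ℕ → Bool} (hh : Primrec h)
    (ha : Computable₂ a) : ComputablePred fun p : ℕ × ℕ => copyLT h a p.1 p.2 := by
  obtain ⟨h1, h2⟩ := computable_pos_pair hh ha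
  exact computablePred_of_decide
    (p := fun p : ℕ × ℕ => pos h a (p.1 + p.2 + 1) p.1 < pos h a (p.1 + p.2 + 1) p.2)
    (Primrec.nat_lt.decide.to_comp.comp h1 h2)

/-! ### Approximations to `Δ₂` sets -/

/-- The conjunction of the values of `f` up to `s`. -/
def allUpTo (f : ℕ → Bool) : ℕ → Bool
  | 0 => f 0
  | s + 1 => allUpTo f s && f (s + 1)

theorem allUpTo_eq_true {f : ℕ → Bool} {s : ℕ} :
    allUpTo f s = true ↔ ∀ z ≤ s, f z = true := by
  induction s with
  | zero => simp [allUpTo]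
  | succ s ih =>
    rw [allUpTo, Bool.and_eq_true, ih]
    constructor
    · rintro ⟨h1, h2⟩ z hz
      rcases Nat.le_succ_iff.1 hz with hz | rfl
      · exact h1 z hz
      · exact h2
    · exact fun H => ⟨fun z hz => H z (by omega), H _ le_rfl⟩

theorem Computable.allUpTo {α : Type*} [Primcodable α] {f : α → ℕ → Bool} {g : α → ℕ}
    (hf : Computable₂ f) (hg : Computable g) :
    Computable fun x => _root_.allUpTo (f x) (g x) := by
  refine (Computable.nat_rec (f := g) (g := fun x => f x 0)
    (h := fun x p => p.2 && f x (p.1 + 1)) hg (hf.comp Computable.id (Computable.const 0))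
    ?_).of_eq fun x => ?_
  · exact Primrec.and.to_comp.comp (Computable.snd.comp Computable.snd)
      (hf.comp Computable.fst (Computable.succ.comp (Computable.fst.comp Computable.snd)))
  · induction g x with
    | zero => rfl
    | succ s ih => rw [_root_.allUpTo, ← ih]

/-- The approximation at stage `s` that compares the least witnesses of `f` and `g`. -/
def compareWitnesses (f g : ℕ → ℕ → Bool) (s : ℕ) : Bool :=
  !allUpTo (fun y => !(allUpTo (f y) s && allUpTo (fun y' => !allUpTo (g y') s) y)) s

theorem compareWitnesses_eq_true {f g : ℕ → ℕ → Bool} {s : ℕ} :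
    compareWitnesses f g s = true ↔
      ∃ y ≤ s, (∀ z ≤ s, f y z = true) ∧ ∀ y' ≤ y, ∃ z ≤ s, g y' z = false := by
  rw [compareWitnesses, Bool.not_eq_true', ← Bool.not_eq_true, allUpTo_eq_true]
  simp only [not_forall, exists_prop, Bool.not_eq_true', Bool.not_eq_false, Bool.and_eq_true,
    allUpTo_eq_true]
  simp only [← Bool.not_eq_true, allUpTo_eq_true, not_forall, exists_prop]

theorem exists_bound_of_forall_exists {g : ℕ → ℕ → Bool} (hg : ∀ y, ∃ z, g y z = false) (m : ℕ) :
    ∃ s₀, ∀ y ≤ m, ∃ z ≤ s₀, g y z = false := by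
  choose z hz using hg
  exact ⟨∑ y ∈ Finset.range (m + 1), z y, fun y hy => ⟨z y,
    Finset.single_le_sum (f := z) (fun _ _ => Nat.zero_le _)
      (Finset.mem_range.2 (Nat.lt_succ_of_le hy)), hz y⟩⟩

theorem compareWitnesses_eventually_true {f g : ℕ → ℕ → Bool} {y : ℕ} (hf : ∀ z, f y z = true)
    (hg : ∀ y, ∃ z, g y z = false) : ∃ s₀, ∀ s, s₀ ≤ s → compareWitnesses f g s = true := by
  obtain ⟨s₀, hs₀⟩ := exists_bound_of_forall_exists hg y
  refine ⟨s₀ + y, fun s hs => compareWitnesses_eq_true.2 ⟨y, by omega, fun z _ => hf z,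
    fun y' hy' => ?_⟩⟩
  obtain ⟨z, hz, hgz⟩ := hs₀ y' hy'
  exact ⟨z, by omega, hgz⟩

/-- Candidates up to `y` are eventually refuted for `f`, and larger ones are blocked by the
unrefuted witness `y` of `g`; ties go to `g`. -/
theorem compareWitnesses_eventually_false {f g : ℕ → ℕ → Bool} {y : ℕ} (hg : ∀ z, g y z = true)
    (hf : ∀ y, ∃ z, f y z = false) : ∃ s₀, ∀ s, s₀ ≤ s → compareWitnesses f g s = false := by
  obtain ⟨s₀, hs₀⟩ := exists_bound_of_forall_exists hf y
  refine ⟨s₀, fun s hs => ?_⟩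
  rw [← Bool.not_eq_true, compareWitnesses_eq_true]
  rintro ⟨w, -, h1, h2⟩
  rcases le_total w y with hwy | hwy
  · obtain ⟨z, hz, hfz⟩ := hs₀ w hwy
    simp [h1 z (hz.trans hs)] at hfz
  · obtain ⟨z, -, hgz⟩ := h2 y hwy
    simp [hg z] at hgz

/-- Every `Δ₂` set is the limit of a computable sequence. -/
theorem IsDelta2.exists_approximation {S : Set ℕ} (hS : IsDelta2 S) :
    ∃ (A : ℕ → Bool) (a : ℕ → ℕ → Bool), (∀ n, A n = true ↔ n ∈ S) ∧ Computable₂ a ∧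
      ∀ n, ∃ s₀, ∀ s, s₀ ≤ s → a n s = A n := by
  classical
  obtain ⟨⟨R, hR, hRS⟩, ⟨Q, hQ, hQS⟩⟩ := hS
  obtain ⟨r, hr, hrR⟩ := ComputablePred.computable_iff.1 hR
  obtain ⟨q, hq, hqQ⟩ := ComputablePred.computable_iff.1 hQ
  subst hrR hqQ
  refine ⟨fun n => decide (n ∈ S),
    fun n => compareWitnesses (fun y z => r (n, y, z)) (fun y z => q (n, y, z)),
    fun n => by simp, ?_, fun n => ?_⟩
  · have hnot : Computable not := Primrec.not.to_comp
    have hall : ∀ {p : ℕ × ℕ × ℕ → Bool}, Computable p →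
        Computable fun x : (ℕ × ℕ) × ℕ => allUpTo (fun z => p (x.1.1, x.2, z)) x.1.2 := by
      intro p hp
      have h1 : Computable₂ fun (x : (ℕ × ℕ) × ℕ) (z : ℕ) => p (x.1.1, x.2, z) :=
        hp.comp (Computable.pair (Computable.fst.comp (Computable.fst.comp Computable.fst))
          (Computable.pair (Computable.snd.comp Computable.fst) Computable.snd))
      exact Computable.allUpTo h1 (Computable.snd.comp Computable.fst)
    have h1 : Computable₂ fun (x : (ℕ × ℕ) × ℕ) (y' : ℕ) =>
        !allUpTo (fun z => q (x.1.1, y', z)) x.1.2 := by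
      have hg : Computable fun x : ((ℕ × ℕ) × ℕ) × ℕ => (x.1.1, x.2) :=
        Computable.pair (Computable.fst.comp Computable.fst) Computable.snd
      have hc := hnot.comp ((hall hq).comp hg)
      exact hc
    have h2 : Computable fun x : (ℕ × ℕ) × ℕ =>
        allUpTo (fun y' => !allUpTo (fun z => q (x.1.1, y', z)) x.1.2) x.2 :=
      Computable.allUpTo h1 Computable.snd
    have h3 : Computable₂ fun (x : ℕ × ℕ) (y : ℕ) =>
        !(allUpTo (fun z => r (x.1, y, z)) x.2 &&
          allUpTo (fun y' => !allUpTo (fun z => q (x.1, y', z)) x.2) y) := by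
      have hc := hnot.comp (Primrec.and.to_comp.comp (hall hr) h2)
      exact hc
    have h4 : Computable fun x : ℕ × ℕ => allUpTo (fun y =>
        !(allUpTo (fun z => r (x.1, y, z)) x.2 &&
          allUpTo (fun y' => !allUpTo (fun z => q (x.1, y', z)) x.2) y)) x.2 :=
      Computable.allUpTo h3 Computable.snd
    have hc := hnot.comp h4
    exact hc
  · have hRn := hRS n
    have hQn := hQS n
    by_cases hn : n ∈ S
    · obtain ⟨y, hy⟩ := hRn.1 hn
      have hno : ∀ y, ∃ z, q (n, y, z) = false := by
        have : ¬ n ∈ Sᶜ := fun h => h hn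
        simpa [hQn] using this
      simpa [hn] using compareWitnesses_eventually_true (f := fun y z => r (n, y, z))
        (g := fun y z => q (n, y, z)) hy hno
    · obtain ⟨y, hy⟩ := hQn.1 hn
      have hno : ∀ y, ∃ z, r (n, y, z) = false := by simpa [hRn] using hn
      simpa [hn] using compareWitnesses_eventually_false (f := fun y z => r (n, y, z))
        (g := fun y z => q (n, y, z)) hy hno

/-! ### Turing degrees of the transported functions -/

open Classical in
/-- If membership in `S` is decided by one query to `S'`, then `S` is Turing reducible to `S'`. -/
theorem turingReducible_of_query {S S' : Set ℕ} {q : ℕ → ℕ} {d : ℕ → ℕ → Bool}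
    (hq : Computable q) (hd : Computable₂ d)
    (hS : ∀ n, n ∈ S ↔ d n (if q n ∈ S' then 1 else 0) = true) :
    TuringReducible (setOracle S) (setOracle S') := by
  rw [TuringReducible, RecursiveIn.iff_nat]
  have hq' : Nat.RecursiveIn {setOracle S'} (fun n => Part.some (q n)) :=
    Nat.Partrec.recursiveIn (Partrec.nat_iff.1 hq)
  have hid : Nat.RecursiveIn {setOracle S'} (fun n => Part.some n) :=
    Nat.Partrec.recursiveIn Nat.Partrec.some
  have ho : Nat.RecursiveIn {setOracle S'} (setOracle S') := .oracle _ rfl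
  have hd' : Nat.RecursiveIn {setOracle S'}
      (fun m => Part.some (d m.unpair.1 m.unpair.2).toNat) := by
    refine Nat.Partrec.recursiveIn (Partrec.nat_iff.1 ?_)
    have : Computable fun m : ℕ => (d m.unpair.1 m.unpair.2).toNat :=
      (Primrec.dom_bool Bool.toNat).to_comp.comp (hd.comp
        (Computable.fst.comp Computable.unpair) (Computable.snd.comp Computable.unpair))
    exact this
  refine Nat.RecursiveIn.of_eq (.comp hd' (.pair hid (.comp ho hq'))) fun n => ?_
  have hb : (Part.some (q n) >>= setOracle S') = Part.some (if q n ∈ S' then 1 else 0) :=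
    Part.bind_some _ _
  by_cases hn : n ∈ S
  · have := (hS n).1 hn
    simp [hb, Seq.seq, this, show setOracle S n = Part.some (if n ∈ S then 1 else 0) from rfl, hn]
  · have : d n (if q n ∈ S' then 1 else 0) = false := by
      rw [← Bool.not_eq_true]
      exact fun h => hn ((hS n).2 h)
    simp [hb, Seq.seq, this, show setOracle S n = Part.some (if n ∈ S then 1 else 0) from rfl, hn]

theorem degSet_eq_of_turingReducible {S S' : Set ℕ}
    (h1 : TuringReducible (setOracle S) (setOracle S'))
    (h2 : TuringReducible (setOracle S') (setOracle S)) : degSet S = degSet S' :=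
  Quotient.sound ⟨h1, h2⟩

/-- The greatest `n ≤ x` with `codeName n ≤ x`. -/
def codeIndex (x : ℕ) : ℕ := Nat.findGreatest (fun n => codeName n ≤ x) x

theorem primrec_codeIndex : Primrec codeIndex :=
  Primrec.nat_findGreatest Primrec.id
    (Primrec.nat_le.comp (primrec_codeName.comp Primrec.snd) Primrec.fst)

theorem strictMono_codeName : StrictMono codeName := fun m n hmn => by
  have := strictMono_stageLen hmn
  rw [codeName, codeName]
  omega

theorem codeIndex_codeName (n : ℕ) : codeIndex (codeName n) = n := by
  have hn : n ≤ codeName n := strictMono_codeName.le_apply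
  have h1 := Nat.findGreatest_spec (P := fun m => codeName m ≤ codeName n) hn le_rfl
  exact le_antisymm (strictMono_codeName.le_iff_le.1 h1)
    (Nat.le_findGreatest (P := fun m => codeName m ≤ codeName n) hn le_rfl)

/-- The `Δ₂` degrees belong to the degree spectrum of the block function. -/
theorem delta2_subset_degSpecFun {h : ℕ → ℕ} (hh : Primrec h)
    (hE : ∀ j, target h (2 * j) = 2 * j) :
    {d : TuringDegree | IsDelta2Degree d} ⊆ degSpecFun (blockFun h) := by
  classical
  rintro _ ⟨S, hS, rfl⟩
  obtain ⟨A, a, hAS, ha, hA⟩ := hS.exists_approximation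
  obtain ⟨φ, hφ, hlt⟩ := exists_limit_equiv hE hA
  let ψ : ((· < ·) : ℕ → ℕ → Prop) ≃r copyLT h a :=
    { toEquiv := φ.symm
      map_rel_iff' := by
        intro x y
        rw [hlt, φ.apply_symm_apply, φ.apply_symm_apply] }
  refine ⟨copyLT h a, ⟨computablePred_copyLT hh ha, ⟨ψ⟩⟩, ψ, ?_⟩
  have hmap : ∀ x y, Relation.Map (fun x y => blockFun h x = y) ψ ψ x y ↔
      blockFun h (φ x) = φ y := by
    intro x y
    constructor
    · rintro ⟨x, y, hxy, rfl, rfl⟩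
      change blockFun h (φ (φ.symm x)) = φ (φ.symm y)
      rwa [φ.apply_symm_apply, φ.apply_symm_apply]
    · exact fun hxy => ⟨φ x, φ y, hxy, φ.symm_apply_apply x, φ.symm_apply_apply y⟩
  refine degSet_eq_of_turingReducible ?_ ?_
  -- Membership of `n` is read off from whether the first name of its pair maps to the second.
  · refine turingReducible_of_query (q := fun n => Nat.pair (codeName n) (codeName n + 1))
      (d := fun _ v => decide (v = 1)) ?_ ?_ fun n => ?_
    · exact (Primrec₂.natPair.comp primrec_codeName
        (Primrec.succ.comp primrec_codeName)).to_comp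
    · exact (Primrec.eq.decide.comp Primrec.snd (Primrec.const 1)).to_comp
    · rw [Set.mem_ofPred_eq, Nat.unpair_pair, hmap, limit_codeName hE hA hφ, ← hAS n]
      cases A n <;> simp
  -- At the first name of a pair the oracle bit gives the value as an offset; at other names the
  -- answer at stage `x + y + 1` is final and the oracle is ignored.
  · obtain ⟨h1, h2⟩ := computable_pos_pair hh ha
    refine turingReducible_of_query (q := fun m => codeIndex m.unpair.1)
      (d := fun m v => bif decide (codeName (codeIndex m.unpair.1) = m.unpair.1) then
        decide (m.unpair.2 = m.unpair.1 + v)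
        else decide (blockFun h (pos h a (m.unpair.1 + m.unpair.2 + 1) m.unpair.1) =
          pos h a (m.unpair.1 + m.unpair.2 + 1) m.unpair.2)) ?_ ?_ fun m => ?_
    · exact (primrec_codeIndex.comp (Primrec.fst.comp Primrec.unpair)).to_comp
    · have hu : Primrec fun p : ℕ × ℕ => p.1.unpair := Primrec.unpair.comp Primrec.fst
      have hu1 : Primrec fun p : ℕ × ℕ => p.1.unpair.1 := Primrec.fst.comp hu
      refine Computable.cond
        (Primrec.eq.decide.comp (primrec_codeName.comp (primrec_codeIndex.comp hu1)) hu1).to_comp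
        (Primrec.eq.decide.comp (Primrec.snd.comp hu)
          (Primrec.nat_add.comp hu1 Primrec.snd)).to_comp
        (Primrec.eq.decide.to_comp.comp ((primrec_blockFun hh).to_comp.comp
          (h1.comp hu.to_comp)) (h2.comp hu.to_comp))
    · rw [Set.mem_ofPred_eq, hmap]
      by_cases hc : codeName (codeIndex m.unpair.1) = m.unpair.1
      · have h3 := limit_codeName hE hA hφ (codeIndex m.unpair.1) m.unpair.2
        rw [hc] at h3
        have h4 := hAS (codeIndex m.unpair.1)
        rw [h3, hc, decide_eq_true rfl, cond_true, decide_eq_true_eq]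
        cases hAc : A (codeIndex m.unpair.1)
        · rw [if_neg (fun hmem => by simp [h4.2 hmem] at hAc), Bool.toNat_false]
        · rw [if_pos (h4.1 hAc), Bool.toNat_true]
      · have hne : ∀ n, m.unpair.1 ≠ codeName n := fun n hn => hc (by
          rw [hn, codeIndex_codeName])
        rw [limit_of_ne_codeName hE hφ hne, decide_eq_false hc, cond_false, decide_eq_true_eq]

theorem mainTheorem2 :
    ∃ f : ℕ → ℕ, Computable f ∧ IsBlockFunction f ∧
      ¬ Computable (cp f) ∧
      (∀ I : Set ℕ, IsFBlock f I → {J : Set ℕ | IsFBlock f J ∧ SameFType f I J}.Infinite) ∧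
      {d : TuringDegree | IsDelta2Degree d} ⊆ degSpecFun f :=
  ⟨blockFun haltEnum, (primrec_blockFun primrec_haltEnum).to_comp, isBlockFunction_blockFun,
    not_computable_cp, fun _ hI => infinite_sameFType hI,
    delta2_subset_degSpecFun primrec_haltEnum target_haltEnum_bit0⟩
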